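/- Let $\mathbb D$ be the unit disc, $\mathbb T$ the unit circle, $m$ the normalized arc length on $\mathbb T$ and $dA=\frac{dx\,dy}{\pi}$. Let $\omega:\mathbb D\to[0,\infty]$ be a positive superharmonic weight, that is, $\omega$ is superharmonic (lower semicontinuous, not identically $\infty$, and $\omega(a)\ge\frac1{2\pi}\int_0^{2\pi}\omega(a+re^{i\theta})\,d\theta$ whenever $\{|z-a|\le r\}\subset\mathbb D$, $r>0$) and integrable with respect to area measure on $\mathbb D$. For $f$ holomorphic on $\mathbb D$ put $$\mathcal D_\omega(f)=\int_{\mathbb D}|f'(z)|^2\,\omega(z)\,dA(z)\in[0,\infty].$$ An outer function is a function $f$ in the Hardy space $H^1$ of the form $$f(z)=\alpha\exp\left(\int_{\mathbb T}\frac{\zeta+z}{\zeta-z}\,h(\zeta)\,dm(\zeta)\right),\qquad z\in\mathbb D,$$ with $|\alpha|=1$ and $h$ a real-valued integrable function on $\mathbb T$. For a function $f$ in a Hardy space write $f^*(\zeta)=\lim_{r\to1^-}f(r\zeta)$, which exists for $m$-almost every $\zeta\in\mathbb T$. For outer functions $f,g$ define, for $z\in\mathbb D$, $$(f\wedge g)(z)=\exp\left(\int_{\mathbb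 T}\frac{\zeta+z}{\zeta-z}\log\min(|f^*(\zeta)|,|g^*(\zeta)|)\,dm(\zeta)\right),$$ $$(f\vee g)(z)=\exp\left(\int_{\mathbb T}\frac{\zeta+z}{\zeta-z}\log\max(|f^*(\zeta)|,|g^*(\zeta)|)\,dm(\zeta)\right).$$ Let $f$ and $g$ be outer functions in the Hardy space $H^2$. Then, as inequalities in $[0,\infty]$, (A) $\mathcal D_\omega(f\vee g)\le\mathcal D_\omega(f)+\mathcal D_\omega(g)$; (B) $\mathcal D_\omega(f\wedge g)\le\mathcal D_\omega(f)+\mathcal D_\omega(g)$; (C) $\mathcal D_\omega(f\wedge f^2)\le4\,\mathcal D_\omega(f)$. -/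

import Mathlib

open scoped ENNReal

/-- A superharmonic function `ω : U → [0, ∞]` on an open set `U ⊆ ℂ`: lower semicontinuous,
finite somewhere, and with the super-mean value property on circles.
Values of `ω` outside `U` play no role. -/
structure IsPosSuperharmonicOn (ω : ℂ → ℝ≥0∞) (U : Set ℂ) : Prop where
  lowerSemicontinuousOn : LowerSemicontinuousOn ω U
  finite_somewhere : ∃ z ∈ U, ω z ≠ ∞
  circle_mean_le : ∀ a : ℂ, ∀ r : ℝ, 0 < r → Metric.closedBall a r ⊆ U →
    (∫⁻ θ in Set.Ioc 0 (2 * Real.pi), ω (circleMap a r θ)) / ENNReal.ofReal (2 * Real.pi) ≤ ω a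

/-- A positive superharmonic weight on the unit disc: a positive superharmonic function that is
integrable with respect to area measure. -/
structure IsSuperharmonicWeight (ω : ℂ → ℝ≥0∞) : Prop where
  superharmonic : IsPosSuperharmonicOn ω (Metric.ball 0 1)
  integrable : ∫⁻ z in Metric.ball (0 : ℂ) 1, ω z < ∞

/-- The Dirichlet integral `D_ω(f) = ∫_𝔻 |f'|² ω dA`, with `dA = dx dy / π`, valued in `[0, ∞]`. -/
noncomputable def dirichletIntegral (ω : ℂ → ℝ≥0∞) (f : ℂ → ℂ) : ℝ≥0∞ :=
  (∫⁻ z in Metric.ball (0 : ℂ) 1, ‖deriv f z‖ₑ ^ 2 * ω z) / ENNReal.ofReal Real.pi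

/-- The Hardy space `H^p` of the unit disc: holomorphic functions with bounded `p`-th integral
means over the circles of radius `r < 1`. -/
def MemHardy (p : ℝ) (f : ℂ → ℂ) : Prop :=
  DifferentiableOn ℂ f (Metric.ball 0 1) ∧
    ∃ C : ℝ, ∀ r ∈ Set.Ioo (0 : ℝ) 1, Real.circleAverage (fun z => ‖f z‖ ^ p) 0 r ≤ C

/-- `exp (∫_𝕋 (ζ + z) / (ζ - z) h(ζ) dm(ζ))`, with `m` normalized arc length on the circle. -/
noncomputable def outerExp (h : ℂ → ℝ) (z : ℂ) : ℂ :=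
  Complex.exp (Real.circleAverage (fun ζ => (ζ + z) / (ζ - z) * (h ζ : ℂ)) 0 1)

/-- Outer functions: functions in `H¹` of the form
`α exp (∫_𝕋 (ζ + z) / (ζ - z) h(ζ) dm(ζ))` on the unit disc, with `h` real-valued and integrable
on the circle and `|α| = 1`. -/
def IsOuter (f : ℂ → ℂ) : Prop :=
  MemHardy 1 f ∧ ∃ (α : ℂ) (h : ℂ → ℝ), ‖α‖ = 1 ∧ CircleIntegrable h 0 1 ∧
    ∀ z ∈ Metric.ball (0 : ℂ) 1, f z = α * outerExp h z

/-- The boundary function `f*(ζ) = lim_{r → 1⁻} f(rζ)`, which exists for almost every `ζ` on the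
circle when `f` lies in a Hardy space. -/
noncomputable def radialLimit (f : ℂ → ℂ) (ζ : ℂ) : ℂ :=
  Filter.limUnder (nhdsWithin (1 : ℝ) (Set.Iio 1)) (fun r : ℝ => f ((r : ℂ) * ζ))

/-- The cut-off `f ∧ g`, the outer function with boundary modulus `min(|f*|, |g*|)`. -/
noncomputable def outerInf (f g : ℂ → ℂ) : ℂ → ℂ :=
  outerExp (fun ζ => Real.log (min ‖radialLimit f ζ‖ ‖radialLimit g ζ‖))

/-- The cut-off `f ∨ g`, the outer function with boundary modulus `max(|f*|, |g*|)`. -/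
noncomputable def outerSup (f g : ℂ → ℂ) : ℂ → ℂ :=
  outerExp (fun ζ => Real.log (max ‖radialLimit f ζ‖ ‖radialLimit g ζ‖))

/-! Write an outer function as a unimodular constant times `outerExp a`; its modulus is the
exponential of the Poisson integral of `a`, and Fatou's theorem together with the `H²` hypothesis
identifies `exp a` with the boundary modulus and makes its square integrable. Everything then rests
on one comparison principle.

Let `uᵢ`, `vⱼ` be finite families of outer functions with `∑|uᵢ|² = ∑|vⱼ|²` on the circle and
`∑|uᵢ|² ≤ ∑|vⱼ|²` in the disc. Then `σ = ∑|vⱼ|² - ∑|uᵢ|²` is nonnegative and its circle means tend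
to zero at the boundary. Since `Δ|v|² = 4|v'|²`, Green's formula formally gives `4∫(∑|vⱼ'|² -
∑|uᵢ'|²)ω = ∫σ Δω ≤ 0`, so the `v` side has the smaller Dirichlet integral
(`sum_dirichletIntegral_le`, `sum_dirichletIntegral_outerExp_le`). As `ω` need not be smooth, the
Laplacian is replaced by the mean over circles of radius `δ` minus the value at the centre, which is
symmetric under integration, and `ω` by a truncation vanishing near the circle.

For (A) and (B), the family `f, g` is compared with `f ∨ g, f ∧ g`. For (C), factor `|f| = HK` with
`H = |f ∧ 1|`, `K = |f ∨ 1|`, so that `|f ∧ f²| = H²K`. The families with moduli `2HK, H², √3` and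
`H²K, √3K, 2H` satisfy the principle, because the difference of their sums of squares is `(K² - 1)(1
- H²)(3 - H²)`. The Dirichlet integral of `(f ∧ 1)²` is at most four times that of `f ∧ 1`, so these
two terms cancel. -/

open scoped ENNReal Topology
open MeasureTheory Filter Metric Set Real

/-! ### Poisson kernel estimates and Fatou's radial limit theorem -/

/-- A kernel of Poisson type has uniformly bounded integral against a function whose averages over
intervals centred at `x` are at most `ε`. -/
lemma lintegral_kernel_mul_le {G : ℝ → ℝ≥0∞} (hG : AEMeasurable G) (x : ℝ) {ε : ℝ≥0∞}
    (h : ∀ τ : ℝ, 0 < τ → ∫⁻ t in closedBall x τ, G t ≤ ε * ENNReal.ofReal τ) {d : ℝ}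
    (hd : 0 < d) :
    ∫⁻ t, ENNReal.ofReal (d / max d |t - x| ^ 2) * G t ≤ 8 * ε := by
  -- Dyadic decomposition: for the least `k` with `|t - x| ≤ 2^k d`, the kernel is at most `4 ·
  -- 4^(-k) / d`. The ball of radius `2^k d` carries mass at most `ε 2^k d`, so the sum is `4ε ∑
  -- 2^(-k) = 8ε`.
  have key : ∀ t, ENNReal.ofReal (d / max d |t - x| ^ 2) * G t ≤
      ∑' k : ℕ, ENNReal.ofReal (4 * (1 / 4) ^ k / d) *
        (closedBall x (2 ^ k * d)).indicator G t := by
    intro t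
    have hex : ∃ k : ℕ, |t - x| ≤ 2 ^ k * d := by
      obtain ⟨k, hk⟩ := pow_unbounded_of_one_lt (|t - x| / d) (one_lt_two)
      exact ⟨k, by rw [div_lt_iff₀ hd] at hk; exact hk.le⟩
    classical
    let k := Nat.find hex
    have hk : |t - x| ≤ 2 ^ k * d := Nat.find_spec hex
    refine le_trans ?_ (ENNReal.le_tsum k)
    rw [indicator_of_mem (by simpa [Real.dist_eq] using hk)]
    refine mul_le_mul' (ENNReal.ofReal_le_ofReal ?_) le_rfl
    rw [div_le_div_iff₀ (by positivity) hd]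
    rcases Nat.eq_zero_or_pos k with h0 | h0
    · have : d ≤ max d |t - x| := le_max_left _ _
      rw [h0]
      nlinarith
    · have h1 : 2 ^ (k - 1) * d < |t - x| := by
        have := Nat.find_min hex (m := k - 1) (by omega)
        simpa using this
      have h2 : 2 ^ (k - 1) * d ≤ max d |t - x| := h1.le.trans (le_max_right _ _)
      have h3 : (2 ^ (k - 1) * d) ^ 2 ≤ max d |t - x| ^ 2 := by gcongr
      obtain ⟨m, hm⟩ : ∃ m, k = m + 1 := ⟨k - 1, by omega⟩
      rw [hm] at h3 ⊢
      simp only [Nat.add_sub_cancel] at h3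
      calc d * d = 4 * (1 / 4) ^ (m + 1) * (2 ^ m * d) ^ 2 := by
            rw [mul_pow, ← pow_mul, mul_comm m 2, pow_mul, pow_succ]
            have : ((1 : ℝ) / 4) ^ m * (2 ^ 2) ^ m = 1 := by rw [← mul_pow]; norm_num
            linear_combination (-d ^ 2) * this
        _ ≤ _ := by gcongr
  calc ∫⁻ t, ENNReal.ofReal (d / max d |t - x| ^ 2) * G t
      ≤ ∫⁻ t, ∑' k : ℕ, ENNReal.ofReal (4 * (1 / 4) ^ k / d) *
        (closedBall x (2 ^ k * d)).indicator G t := lintegral_mono key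
    _ = ∑' k : ℕ, ENNReal.ofReal (4 * (1 / 4) ^ k / d) *
        ∫⁻ t in closedBall x (2 ^ k * d), G t := by
      rw [lintegral_tsum]
      · congr with k
        rw [lintegral_const_mul' _ _ ENNReal.ofReal_ne_top,
          lintegral_indicator isClosed_closedBall.measurableSet]
      · intro k
        exact ((hG.indicator isClosed_closedBall.measurableSet).const_mul _)
    _ ≤ ∑' k : ℕ, 4 * ε * (2⁻¹ : ℝ≥0∞) ^ k := by
      refine ENNReal.tsum_le_tsum fun k => ?_
      refine (mul_le_mul_right (h (2 ^ k * d) (by positivity)) _).trans (le_of_eq ?_)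
      rw [mul_comm ε, ← mul_assoc, ← ENNReal.ofReal_mul (by positivity)]
      have : 4 * (1 / 4) ^ k / d * (2 ^ k * d) = 4 * (2⁻¹ : ℝ) ^ k := by
        rw [show (2⁻¹ : ℝ) = 1 / 4 * 2 by norm_num, mul_pow]
        field_simp
      rw [this, ENNReal.ofReal_mul (by norm_num), ENNReal.ofReal_pow (by norm_num),
        ENNReal.ofReal_inv_of_pos (by norm_num)]
      simp only [ENNReal.ofReal_ofNat]
      ring
    _ = 8 * ε := by
      rw [ENNReal.tsum_mul_left, ENNReal.tsum_geometric, ENNReal.one_sub_inv_two, inv_inv]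
      ring

/-- The chord has length `2|sin((t - x)/2)|`, so this is Jordan's inequality for the sine. -/
lemma two_div_pi_mul_abs_le_norm_circleMap_sub {t x : ℝ} (h : |t - x| ≤ π) :
    2 / π * |t - x| ≤ ‖circleMap 0 1 t - circleMap 0 1 x‖ := by
  have e : circleMap 0 1 t - circleMap 0 1 x =
      circleMap 0 1 x * (Complex.exp (Complex.I * ((t - x : ℝ) : ℂ)) - 1) := by
    simp only [circleMap_zero, Complex.ofReal_one, one_mul, mul_sub, mul_one, ← Complex.exp_add]
    congr 2
    push_cast
    ring
  rw [e, norm_mul, norm_circleMap_zero, Complex.norm_exp_I_mul_ofReal_sub_one, abs_one, one_mul,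
    norm_mul, Real.norm_eq_abs, Real.norm_eq_abs]
  have := Real.mul_abs_le_abs_sin (x := (t - x) / 2) (by rw [abs_div, abs_two]; linarith)
  rw [abs_div, abs_two] at this
  rw [abs_two]
  linarith

/-- The distance `D` between the two points is at least `1 - r` and at least `|t - x| / π`, so the
maximum is at most `πD`; the numerator `(1 + r)(1 - r)` is at most `2(1 - r)`. -/
lemma poissonKernel_radial_le {t x r : ℝ} (h : |t - x| ≤ π) (hr : r ∈ Ioo (0 : ℝ) 1) :
    poissonKernel 0 (r * circleMap 0 1 x) (circleMap 0 1 t) ≤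
      2 * π ^ 2 * ((1 - r) / max (1 - r) |t - x| ^ 2) := by
  obtain ⟨h0, h1⟩ := hr
  have hn : ‖(r : ℂ) * circleMap 0 1 x‖ = r := by simp [abs_of_pos h0]
  have hd : 0 < 1 - r := by linarith
  rw [poissonKernel_def]
  simp only [sub_zero, hn, norm_circleMap_zero, abs_one]
  set D := ‖circleMap 0 1 t - r * circleMap 0 1 x‖
  have hD1 : 1 - r ≤ D := by
    have := norm_sub_norm_le (circleMap 0 1 t) (r * circleMap 0 1 x)
    rw [hn] at this
    simpa using this
  have hD2 : |t - x| ≤ π * D := by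
    have h2 := two_div_pi_mul_abs_le_norm_circleMap_sub h
    have h3 : ‖circleMap 0 1 t - circleMap 0 1 x‖ ≤ D + (1 - r) := by
      have : ‖(r : ℂ) * circleMap 0 1 x - circleMap 0 1 x‖ = 1 - r := by
        rw [← sub_one_mul, norm_mul, norm_circleMap_zero, abs_one, mul_one,
          ← Complex.ofReal_one, ← Complex.ofReal_sub, Complex.norm_real, Real.norm_eq_abs,
          abs_sub_comm, abs_of_pos hd]
      rw [← this]
      exact norm_sub_le_norm_sub_add_norm_sub _ _ _
    have h4 : 2 / π * |t - x| ≤ 2 * D := by linarith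
    rw [div_mul_eq_mul_div, div_le_iff₀ pi_pos] at h4
    linarith
  have hD0 : 0 < D := hd.trans_le hD1
  have hpi : 1 ≤ π := by linarith [pi_gt_three]
  have hm : max (1 - r) |t - x| ≤ π * D := max_le (by nlinarith) hD2
  have hm0 : 0 < max (1 - r) |t - x| := lt_max_of_lt_left hd
  rw [← mul_div_assoc, div_le_div_iff₀ (by positivity) (by positivity)]
  calc (1 ^ 2 - r ^ 2) * max (1 - r) |t - x| ^ 2 ≤ (1 ^ 2 - r ^ 2) * (π * D) ^ 2 := by
        have : 0 ≤ 1 ^ 2 - r ^ 2 := by nlinarith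
        gcongr
    _ = (1 + r) * (1 - r) * π ^ 2 * D ^ 2 := by ring
    _ ≤ 2 * (1 - r) * π ^ 2 * D ^ 2 := by gcongr; linarith
    _ = _ := by ring

/-- Split at distance `τ₀` from `x`: the near part is at most `8ε` uniformly in `d`, while on the
far part the kernel is at most `d / τ₀²`, which tends to zero. -/
lemma tendsto_lintegral_kernel_mul {G : ℝ → ℝ≥0∞} (hG : AEMeasurable G) {x a : ℝ}
    (hB : ∫⁻ t in closedBall x a, G t ≠ ∞)
    (h : ∀ ε : ℝ, 0 < ε → ∃ τ₀ > 0, ∀ τ ∈ Ioc 0 τ₀,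
      ∫⁻ t in closedBall x τ, G t ≤ ENNReal.ofReal (ε * τ)) :
    Tendsto (fun d : ℝ => ∫⁻ t in closedBall x a, ENNReal.ofReal (d / max d |t - x| ^ 2) * G t)
      (𝓝[>] 0) (𝓝 0) := by
  set B := ∫⁻ t in closedBall x a, G t
  have main : ∀ ε : ℝ, 0 < ε → ∃ τ₀ > 0, ∀ d > 0,
      ∫⁻ t in closedBall x a, ENNReal.ofReal (d / max d |t - x| ^ 2) * G t ≤
        8 * ENNReal.ofReal ε + ENNReal.ofReal (d / τ₀ ^ 2) * B := by
    intro ε hε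
    obtain ⟨τ₀, hτ₀, hτ⟩ := h ε hε
    refine ⟨τ₀, hτ₀, fun d hd => ?_⟩
    have hG' : AEMeasurable ((closedBall x τ₀).indicator G) :=
      hG.indicator isClosed_closedBall.measurableSet
    have h1 := lintegral_kernel_mul_le hG' x (ε := ENNReal.ofReal ε) (fun τ hτ' => by
      rw [lintegral_indicator isClosed_closedBall.measurableSet,
        Measure.restrict_restrict isClosed_closedBall.measurableSet,
        ← ENNReal.ofReal_mul hε.le]
      rcases le_total τ τ₀ with hle | hle
      · exact (lintegral_mono_set inter_subset_right).trans (hτ τ ⟨hτ', hle⟩)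
      · refine (lintegral_mono_set inter_subset_left).trans ((hτ τ₀ ⟨hτ₀, le_rfl⟩).trans ?_)
        gcongr) hd
    calc ∫⁻ t in closedBall x a, ENNReal.ofReal (d / max d |t - x| ^ 2) * G t
        ≤ ∫⁻ t in closedBall x a, (ENNReal.ofReal (d / max d |t - x| ^ 2) *
            (closedBall x τ₀).indicator G t + ENNReal.ofReal (d / τ₀ ^ 2) * G t) := by
          refine lintegral_mono fun t => ?_
          by_cases ht : t ∈ closedBall x τ₀
          · rw [indicator_of_mem ht]
            exact le_self_add
          · rw [indicator_of_notMem ht, mul_zero, zero_add]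
            refine mul_le_mul' (ENNReal.ofReal_le_ofReal ?_) le_rfl
            have : τ₀ ≤ max d |t - x| := by
              rw [mem_closedBall, Real.dist_eq, not_le] at ht
              exact ht.le.trans (le_max_right _ _)
            gcongr
      _ = (∫⁻ t in closedBall x a, ENNReal.ofReal (d / max d |t - x| ^ 2) *
            (closedBall x τ₀).indicator G t) + ENNReal.ofReal (d / τ₀ ^ 2) * B := by
          rw [lintegral_add_left', lintegral_const_mul' _ _ ENNReal.ofReal_ne_top]
          exact (Measurable.aemeasurable (by fun_prop)).mul hG'.restrict
      _ ≤ _ := by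
          gcongr
          exact (setLIntegral_le_lintegral _ _).trans h1
  rw [ENNReal.tendsto_nhds_zero]
  intro e he
  obtain ⟨ε, hε, hεe⟩ : ∃ ε : ℝ, 0 < ε ∧ 8 * ENNReal.ofReal ε ≤ e / 2 := by
    obtain ⟨c, hc0, hc⟩ := ENNReal.lt_iff_exists_nnreal_btwn.1
      (show (0 : ℝ≥0∞) < e / 16 from ENNReal.div_pos he.ne' (by norm_num))
    refine ⟨c, by exact_mod_cast hc0, ?_⟩
    rw [ENNReal.ofReal_coe_nnreal]
    calc (8 : ℝ≥0∞) * c ≤ 8 * (e / 16) := by gcongr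
      _ = e / 2 := by
        rw [show (16 : ℝ≥0∞) = 8 * 2 by norm_num, ← ENNReal.mul_div_mul_left e 2 (c := 8)
          (by norm_num) (by norm_num), mul_div_assoc]
  obtain ⟨τ₀, hτ₀, hm⟩ := main ε hε
  have hlim : Tendsto (fun d : ℝ => ENNReal.ofReal (d / τ₀ ^ 2) * B) (𝓝[>] 0) (𝓝 0) := by
    have h1 : Tendsto (fun d : ℝ => ENNReal.ofReal (d / τ₀ ^ 2)) (𝓝[>] 0) (𝓝 0) := by
      have : Tendsto (fun d : ℝ => ENNReal.ofReal (d / τ₀ ^ 2)) (𝓝 0)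
          (𝓝 (ENNReal.ofReal (0 / τ₀ ^ 2))) :=
        ENNReal.tendsto_ofReal (tendsto_id.div_const _)
      rw [zero_div, ENNReal.ofReal_zero] at this
      exact this.mono_left nhdsWithin_le_nhds
    simpa using ENNReal.Tendsto.mul_const h1 (Or.inr hB)
  filter_upwards [ENNReal.tendsto_nhds_zero.1 hlim (e / 2) (ENNReal.div_pos he.ne' (by norm_num)),
    self_mem_nhdsWithin] with d hd hd0
  calc _ ≤ _ := hm d hd0
    _ ≤ e / 2 + e / 2 := by gcongr
    _ = e := ENNReal.add_halves e

lemma continuousOn_poissonKernel_sphere {w : ℂ} (hw : w ∈ ball (0 : ℂ) 1) :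
    ContinuousOn (poissonKernel 0 w) (sphere 0 |1|) := by
  rw [poissonKernel_eq_re_herglotzRieszKernel]
  exact Complex.continuous_re.comp_continuousOn (continuousOn_herglotzRieszKernel_sphere hw)

lemma poissonKernel_nonneg {w : ℂ} (hw : w ∈ ball (0 : ℂ) 1) {z : ℂ} (hz : ‖z‖ = 1) :
    0 ≤ poissonKernel 0 w z := by
  rw [poissonKernel_def]
  have : ‖w‖ < 1 := by simpa using hw
  simp only [sub_zero, hz]
  have : 0 ≤ 1 ^ 2 - ‖w‖ ^ 2 := by nlinarith [norm_nonneg w]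
  positivity

lemma circleAverage_poissonKernel {w : ℂ} (hw : w ∈ ball (0 : ℂ) 1) :
    circleAverage (poissonKernel 0 w) 0 1 = 1 := by
  have h := (diffContOnCl_const (𝕜 := ℂ) (s := ball (0 : ℂ) 1)
    (c := (1 : ℂ))).circleAverage_poissonKernel_smul hw
  have h2 := Complex.reCLM.circleAverage_comp_comm (f := poissonKernel 0 w • fun _ => (1 : ℂ))
    (c := 0) (R := 1) (ContinuousOn.circleIntegrable zero_le_one (by
      have := continuousOn_poissonKernel_sphere hw
      rw [abs_one] at this
      exact this.smul continuousOn_const))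
  rw [h] at h2
  simpa [Function.comp_def] using h2

section Radial

variable {E : Type*} [NormedAddCommGroup E] [NormedSpace ℝ E]

/-- The Poisson integral of a function on the unit circle. -/
noncomputable def poissonIntegral (φ : ℂ → E) (z : ℂ) : E :=
  circleAverage (fun ζ => poissonKernel 0 z ζ • φ ζ) 0 1

lemma circleIntegrable_poissonKernel_smul {φ : ℂ → E} (hφ : CircleIntegrable φ 0 1) {w : ℂ}
    (hw : w ∈ ball (0 : ℂ) 1) : CircleIntegrable (fun ζ => poissonKernel 0 w ζ • φ ζ) 0 1 :=
  hφ.continuousOn_smul (continuousOn_poissonKernel_sphere hw)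

lemma poissonIntegral_const [CompleteSpace E] (a : E) {w : ℂ} (hw : w ∈ ball (0 : ℂ) 1) :
    poissonIntegral (fun _ => a) w = a := by
  have h1 : ∫ θ in (0 : ℝ)..2 * π, poissonKernel 0 w (circleMap 0 1 θ) • a =
      (∫ θ in (0 : ℝ)..2 * π, poissonKernel 0 w (circleMap 0 1 θ)) • a :=
    intervalIntegral.integral_smul_const _ _
  have h2 := circleAverage_poissonKernel hw
  rw [circleAverage_def, smul_eq_mul] at h2
  rw [poissonIntegral, circleAverage_def, h1, smul_smul, h2, one_smul]

lemma mul_circleMap_mem_ball {r : ℝ} (hr : r ∈ Ioo (0 : ℝ) 1) (x : ℝ) :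
    (r : ℂ) * circleMap 0 1 x ∈ ball (0 : ℂ) 1 := by
  simpa [abs_of_pos hr.1] using hr.2

/-- The kernel has mean one, so the difference is an average of the kernel against `φ - φ(x)`. The
period is recentred at `x` so that the angular kernel bound applies; `π` is `(2π)⁻¹ · 2π²`. -/
lemma enorm_poissonIntegral_sub_le [CompleteSpace E] {φ : ℂ → E} (hφ : CircleIntegrable φ 0 1) {r : ℝ}
    (hr : r ∈ Ioo (0 : ℝ) 1) (x : ℝ) :
    ‖poissonIntegral φ (r * circleMap 0 1 x) - φ (circleMap 0 1 x)‖ₑ ≤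
      ENNReal.ofReal π * ∫⁻ t in closedBall x π,
        ENNReal.ofReal ((1 - r) / max (1 - r) |t - x| ^ 2) *
          ‖φ (circleMap 0 1 t) - φ (circleMap 0 1 x)‖ₑ := by
  set a := φ (circleMap 0 1 x)
  have hw := mul_circleMap_mem_ball hr x
  set w : ℂ := r * circleMap 0 1 x with hwdef
  have e : poissonIntegral φ w - a =
      circleAverage (fun ζ => poissonKernel 0 w ζ • (φ ζ - a)) 0 1 := by
    conv_lhs => rw [← poissonIntegral_const a hw]
    rw [poissonIntegral, poissonIntegral, ← circleAverage_fun_sub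
      (circleIntegrable_poissonKernel_smul hφ hw)
      (circleIntegrable_poissonKernel_smul (circleIntegrable_const _ _ _) hw)]
    simp_rw [smul_sub]
  rw [e, circleAverage_eq_integral_add (x - π),
    intervalIntegral.integral_comp_add_right
      (fun θ => poissonKernel 0 w (circleMap 0 1 θ) • (φ (circleMap 0 1 θ) - a)),
    enorm_smul, intervalIntegral.integral_of_le (by linarith [pi_pos])]
  calc _ ≤ ‖(2 * π)⁻¹‖ₑ * ∫⁻ t in Ioc (0 + (x - π)) (2 * π + (x - π)),
        ‖poissonKernel 0 w (circleMap 0 1 t) • (φ (circleMap 0 1 t) - a)‖ₑ := by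
        gcongr
        exact enorm_integral_le_lintegral_enorm _
    _ ≤ ‖(2 * π)⁻¹‖ₑ * ∫⁻ t in closedBall x π,
        ‖poissonKernel 0 w (circleMap 0 1 t) • (φ (circleMap 0 1 t) - a)‖ₑ := by
        gcongr
        rw [Real.closedBall_eq_Icc]
        refine Ioc_subset_Icc_self.trans (Icc_subset_Icc ?_ ?_) <;> linarith
    _ ≤ ‖(2 * π)⁻¹‖ₑ * ∫⁻ t in closedBall x π, ENNReal.ofReal (2 * π ^ 2) *
        (ENNReal.ofReal ((1 - r) / max (1 - r) |t - x| ^ 2) * ‖φ (circleMap 0 1 t) - a‖ₑ) := by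
        refine mul_le_mul' le_rfl
          (setLIntegral_mono' isClosed_closedBall.measurableSet fun t ht => ?_)
        rw [mem_closedBall, Real.dist_eq] at ht
        rw [enorm_smul, ← mul_assoc, ← ENNReal.ofReal_mul (by positivity),
          Real.enorm_of_nonneg (poissonKernel_nonneg hw (by simp))]
        gcongr
        exact poissonKernel_radial_le ht hr
    _ = _ := by
        rw [lintegral_const_mul' _ _ ENNReal.ofReal_ne_top, ← mul_assoc,
          Real.enorm_of_nonneg (by positivity), ← ENNReal.ofReal_mul (by positivity)]
        congr 2
        field_simp

/-- **Fatou's theorem**: the Poisson integral of an integrable function on the circle has that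
function as its radial limit almost everywhere. -/
theorem ae_tendsto_poissonIntegral [CompleteSpace E] {φ : ℂ → E} (hφ : CircleIntegrable φ 0 1) :
    ∀ᵐ x : ℝ, Tendsto (fun r : ℝ => poissonIntegral φ (r * circleMap 0 1 x)) (𝓝[<] 1)
      (𝓝 (φ (circleMap 0 1 x))) := by
  set g : ℝ → E := fun x => φ (circleMap 0 1 x) with hg
  have hper : Function.Periodic g (2 * π) := fun x => by
    simp only [hg, periodic_circleMap 0 1 x]
  have hint : ∀ a b, IntervalIntegrable g volume a b :=
    hper.intervalIntegrable₀ (by positivity) hφ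
  have hball : ∀ x a, IntegrableOn g (closedBall x a) := fun x a => by
    rw [Real.closedBall_eq_Icc]
    refine ((intervalIntegrable_iff_integrableOn_Icc_of_le (a := x - |a|) (b := x + |a|)
      (by linarith [abs_nonneg a])).1 (hint _ _)).mono_set (Icc_subset_Icc ?_ ?_) <;>
    linarith [le_abs_self a]
  have hloc : LocallyIntegrable g volume := fun x =>
    ⟨closedBall x 1, closedBall_mem_nhds x one_pos, hball x 1⟩
  -- Convergence holds at every Lebesgue point of the periodic lift of `φ`.
  filter_upwards [IsUnifLocDoublingMeasure.ae_tendsto_average_norm_sub.{0, _, 0} volume hloc 1]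
    with x hx
  have hx' : Tendsto (fun δ : ℝ => ⨍ y in closedBall x δ, ‖g y - g x‖) (𝓝[>] 0) (𝓝 0) := by
    refine hx (fun _ => x) (fun δ => δ) tendsto_id ?_
    filter_upwards [self_mem_nhdsWithin] with δ hδ
    simpa using (mem_Ioi.1 hδ).le
  have hdiff : ∀ a, IntegrableOn (fun t => g t - g x) (closedBall x a) := fun a =>
    (hball x a).sub (integrableOn_const measure_closedBall_lt_top.ne)
  have hlim := tendsto_lintegral_kernel_mul (G := fun t => ‖g t - g x‖ₑ) (x := x) (a := π)
    ((hloc.aestronglyMeasurable.sub aestronglyMeasurable_const).enorm)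
    (hdiff π).2.ne (fun ε hε => by
      -- Half of `ε`, because the interval of radius `τ` has length `2τ`.
      have h1 := (hx'.eventually (gt_mem_nhds (show 0 < ε / 2 by positivity)))
      rw [eventually_nhdsWithin_iff, Metric.eventually_nhds_iff] at h1
      obtain ⟨τ₀, hτ₀, hτ⟩ := h1
      refine ⟨τ₀ / 2, by positivity, fun τ hmem => ?_⟩
      have h2 := hτ (y := τ) (by
        rw [Real.dist_eq, sub_zero, abs_of_pos hmem.1]; linarith [hmem.2]) hmem.1
      rw [setAverage_eq, smul_eq_mul, Measure.real, Real.volume_closedBall,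
        ENNReal.toReal_ofReal (by linarith [hmem.1]), inv_mul_lt_iff₀ (by linarith [hmem.1])] at h2
      rw [← ofReal_integral_norm_eq_lintegral_enorm (hdiff τ)]
      exact ENNReal.ofReal_le_ofReal (by linarith))
  have hsub : Tendsto (fun r : ℝ => 1 - r) (𝓝[<] 1) (𝓝[>] 0) := by
    refine tendsto_nhdsWithin_iff.2 ⟨?_, ?_⟩
    · have : Tendsto (fun r : ℝ => 1 - r) (𝓝 1) (𝓝 (1 - 1)) := tendsto_const_nhds.sub tendsto_id
      rw [sub_self] at this
      exact this.mono_left nhdsWithin_le_nhds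
    · filter_upwards [self_mem_nhdsWithin] with r hr
      exact sub_pos.2 (mem_Iio.1 hr)
  have hlim2 := ENNReal.Tendsto.const_mul (a := ENNReal.ofReal π) (hlim.comp hsub)
    (Or.inr ENNReal.ofReal_ne_top)
  rw [mul_zero] at hlim2
  rw [tendsto_iff_edist_tendsto_0]
  refine tendsto_of_tendsto_of_tendsto_of_le_of_le' tendsto_const_nhds hlim2
    (Eventually.of_forall fun _ => zero_le) ?_
  filter_upwards [Ioo_mem_nhdsLT (show (0 : ℝ) < 1 by norm_num)] with r hr
  rw [edist_eq_enorm_sub]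
  exact enorm_poissonIntegral_sub_le hφ hr x

end Radial

/-! ### Functions in `H²` as Poisson integrals, and their radial limits -/

/-- Banach–Alaoglu transported through the Riesz isometry. Passing to an ultrafilter replaces the
extraction of a weakly convergent subsequence. -/
lemma exists_weak_limit_of_bounded {H : Type*} [NormedAddCommGroup H] [InnerProductSpace ℂ H]
    [CompleteSpace H] {ι : Type*} (U : Ultrafilter ι) (x : ι → H) (C : ℝ) (hx : ∀ i, ‖x i‖ ≤ C) :
    ∃ y : H, ∀ v : H, Tendsto (fun i => inner ℂ (x i) v) U (𝓝 (inner ℂ y v)) := by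
  have hc := WeakDual.isCompact_closedBall (𝕜 := ℂ) (E := H) 0 C
  let T : ι → WeakDual ℂ H := fun i => StrongDual.toWeakDual (InnerProductSpace.toDual ℂ H (x i))
  obtain ⟨Λ, -, hΛ⟩ := hc.ultrafilter_le_nhds (U.map T) (by
    rw [Ultrafilter.coe_map, le_principal_iff, mem_map]
    refine Filter.univ_mem' fun i => ?_
    simpa [T] using hx i)
  refine ⟨(InnerProductSpace.toDual ℂ H).symm (WeakDual.toStrongDual Λ), fun v => ?_⟩
  have h1 : Tendsto T U (𝓝 Λ) := hΛ
  have h2 := ((WeakDual.eval_continuous v).tendsto Λ).comp h1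
  simpa [T, Function.comp_def] using h2

/-- Arc length on the unit circle, as a measure on `ℂ`. -/
noncomputable def arcLength : Measure ℂ :=
  Measure.map (circleMap 0 1) (volume.restrict (Ioc 0 (2 * π)))

instance : IsFiniteMeasure arcLength := by
  unfold arcLength; infer_instance

lemma ae_arcLength_mem_sphere : ∀ᵐ ζ ∂arcLength, ζ ∈ sphere (0 : ℂ) 1 := by
  exact (ae_map_iff (p := fun ζ => ζ ∈ sphere (0 : ℂ) 1) (by fun_prop)
    isClosed_sphere.measurableSet).2 (Eventually.of_forall fun θ => by simp)

lemma aestronglyMeasurable_arcLength {E : Type*} [NormedAddCommGroup E]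
    {φ : ℂ → E} (hφ : ContinuousOn φ (sphere 0 1)) : AEStronglyMeasurable φ arcLength := by
  have h := hφ.aestronglyMeasurable_of_isCompact (μ := arcLength) (isCompact_sphere _ _)
    isClosed_sphere.measurableSet
  rwa [Measure.restrict_eq_self_of_ae_mem ae_arcLength_mem_sphere] at h

lemma circleAverage_eq_integral_arcLength {E : Type*} [NormedAddCommGroup E] [NormedSpace ℝ E]
    {φ : ℂ → E} (hφ : AEStronglyMeasurable φ arcLength) :
    circleAverage φ 0 1 = (2 * π)⁻¹ • ∫ ζ, φ ζ ∂arcLength := by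
  rw [circleAverage_def, arcLength, integral_map (by fun_prop) hφ,
    intervalIntegral.integral_of_le (by positivity)]

lemma circleIntegrable_of_integrable_arcLength {E : Type*} [NormedAddCommGroup E]
    {φ : ℂ → E} (hφ : Integrable φ arcLength) : CircleIntegrable φ 0 1 := by
  rw [CircleIntegrable, intervalIntegrable_iff_integrableOn_Ioc_of_le (by positivity)]
  exact (integrable_map_measure hφ.1 (by fun_prop)).1 hφ

lemma memLp_arcLength {E : Type*} [NormedAddCommGroup E]
    {φ : ℂ → E} (hφ : ContinuousOn φ (sphere 0 1)) (p : ℝ≥0∞) : MemLp φ p arcLength := by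
  obtain ⟨C, hC⟩ := (isCompact_sphere (0 : ℂ) 1).exists_bound_of_continuousOn hφ
  refine MemLp.of_bound (aestronglyMeasurable_arcLength hφ) C ?_
  filter_upwards [ae_arcLength_mem_sphere] with ζ hζ using hC ζ hζ

/-- A function in the Hardy space `H²` is the Poisson integral of an integrable function. -/
lemma MemHardy.exists_eq_poissonIntegral {f : ℂ → ℂ} (hf : MemHardy 2 f) :
    ∃ φ : ℂ → ℂ, CircleIntegrable φ 0 1 ∧ ∀ z ∈ ball (0 : ℂ) 1, f z = poissonIntegral φ z := by
  obtain ⟨hd, C, hC⟩ := hf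
  -- The shift by two keeps every radius, including the first, strictly between 0 and 1.
  let R : ℕ → ℝ := fun n => 1 - 1 / ((n : ℝ) + 2)
  have hR : ∀ n, R n ∈ Ioo (0 : ℝ) 1 := fun n => by
    have h1 : (0 : ℝ) < 1 / ((n : ℝ) + 2) := by positivity
    have h2 : 1 / ((n : ℝ) + 2) < 1 := by
      rw [div_lt_one (by positivity)]
      have : (0 : ℝ) ≤ n := n.cast_nonneg
      linarith
    exact ⟨by simp only [R]; linarith, by simp only [R]; linarith⟩
  have hRlim : Tendsto R atTop (𝓝 1) := by
    have : Tendsto (fun n : ℕ => 1 / ((n : ℝ) + 2)) atTop (𝓝 0) :=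
      tendsto_const_nhds.div_atTop (tendsto_atTop_add_const_right _ _ tendsto_natCast_atTop_atTop)
    simpa [R] using tendsto_const_nhds (x := (1 : ℝ)).sub this
  let F : ℕ → ℂ → ℂ := fun n ζ => f (R n * ζ)
  have hmaps : ∀ n, MapsTo (fun ζ : ℂ => (R n : ℂ) * ζ) (closedBall 0 1) (ball 0 1) :=
    fun n ζ hζ => by
      have h1 : ‖ζ‖ ≤ 1 := by simpa using hζ
      simp only [mem_ball, dist_zero_right, norm_mul, Complex.norm_real, Real.norm_eq_abs,
        abs_of_pos (hR n).1]
      nlinarith [(hR n).1, (hR n).2, norm_nonneg ζ]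
  have hFd : ∀ n, DifferentiableOn ℂ (F n) (ball 0 1) := fun n =>
    hd.comp (by fun_prop) ((hmaps n).mono_left ball_subset_closedBall)
  have hFc : ∀ n, ContinuousOn (F n) (closedBall 0 1) := fun n =>
    hd.continuousOn.comp (by fun_prop) (hmaps n)
  have hFm : ∀ n, MemLp (F n) 2 arcLength := fun n =>
    memLp_arcLength ((hFc n).mono sphere_subset_closedBall) 2
  have hFn : ∀ n, ‖(hFm n).toLp‖ ≤ √(2 * π * C) := fun n => by
    refine Real.le_sqrt_of_sq_le ?_
    have h1 := hC (R n) (hR n)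
    rw [circleAverage_eq_circleAverage_zero_one, circleAverage_eq_integral_arcLength] at h1
    · rw [← inner_self_eq_norm_sq (𝕜 := ℂ), L2.inner_def, ← integral_re]
      · rw [smul_eq_mul, inv_mul_le_iff₀ (by positivity)] at h1
        refine le_of_eq_of_le (integral_congr_ae ?_) h1
        filter_upwards [(hFm n).coeFn_toLp] with ζ hζ
        rw [hζ, inner_self_eq_norm_sq (𝕜 := ℂ)]
        simp [F]
      · exact L2.integrable_inner _ _
    · refine aestronglyMeasurable_arcLength
        (ContinuousOn.congr (f := fun ζ => ‖F n ζ‖ ^ (2 : ℝ)) ?_ fun ζ _ => by simp [F])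
      exact ((((hFc n).mono sphere_subset_closedBall).norm.rpow_const (by norm_num)))
  -- The dilates are bounded in `L²` of the circle; their weak limit is the boundary function.
  -- Pairing with the Poisson kernel, which lies in `L²`, carries the Poisson formula for the
  -- dilates to the limit.
  obtain ⟨φ, hφ⟩ := exists_weak_limit_of_bounded (hyperfilter ℕ) (fun n => (hFm n).toLp) _ hFn
  have hφi : Integrable φ arcLength := (Lp.memLp φ).integrable (by norm_num)
  refine ⟨φ, circleIntegrable_of_integrable_arcLength hφi, fun z hz => ?_⟩
  have hPc : ContinuousOn (poissonKernel 0 z) (sphere 0 1) := by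
    simpa using continuousOn_poissonKernel_sphere hz
  have hPc' : ContinuousOn (fun ζ => (poissonKernel 0 z ζ : ℂ)) (sphere 0 1) :=
    Complex.continuous_ofReal.comp_continuousOn hPc
  have hPm := memLp_arcLength hPc' 2
  have h1 := hφ hPm.toLp
  have e : ∀ (u : Lp ℂ 2 arcLength) (v : ℂ → ℂ), u =ᵐ[arcLength] v →
      inner ℂ u hPm.toLp = starRingEnd ℂ (∫ ζ, poissonKernel 0 z ζ • v ζ ∂arcLength) := by
    intro u v huv
    rw [L2.inner_def, ← integral_conj]
    refine integral_congr_ae ?_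
    filter_upwards [huv, hPm.coeFn_toLp] with ζ h1 h2
    rw [h1, h2]
    simp
  have h2 : Tendsto (fun n => ∫ ζ, poissonKernel 0 z ζ • F n ζ ∂arcLength) (hyperfilter ℕ)
      (𝓝 (∫ ζ, poissonKernel 0 z ζ • φ ζ ∂arcLength)) := by
    have h3 := (Complex.continuous_conj.tendsto _).comp h1
    simp only [Function.comp_def, e _ _ (hFm _).coeFn_toLp, e φ φ (ae_eq_refl _),
      Complex.conj_conj] at h3
    exact h3
  have h3 : ∀ n, (2 * π)⁻¹ • ∫ ζ, poissonKernel 0 z ζ • F n ζ ∂arcLength = f (R n * z) := by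
    intro n
    have hcl : DiffContOnCl ℂ (F n) (ball 0 1) :=
      ⟨hFd n, by rw [closure_ball _ one_ne_zero]; exact hFc n⟩
    have := hcl.circleAverage_poissonKernel_smul hz
    rwa [circleAverage_eq_integral_arcLength
      (aestronglyMeasurable_arcLength (hPc.smul ((hFc n).mono sphere_subset_closedBall)))] at this
  have h4 := h2.const_smul (2 * π)⁻¹
  simp only [h3] at h4
  rw [poissonIntegral, circleAverage_eq_integral_arcLength
    (φ := fun ζ => poissonKernel 0 z ζ • φ ζ)
    ((aestronglyMeasurable_arcLength hPc).smul hφi.1)]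
  refine tendsto_nhds_unique (Tendsto.mono_left ?_ Nat.hyperfilter_le_atTop) h4
  have h5 : Tendsto (fun n => (R n : ℂ) * z) atTop (𝓝 (1 * z)) :=
    ((Complex.continuous_ofReal.tendsto 1).comp hRlim).mul_const z
  rw [one_mul] at h5
  exact ((hd.differentiableAt (isOpen_ball.mem_nhds hz)).continuousAt.tendsto).comp h5

/-- Functions in `H²` have radial limits almost everywhere. -/
theorem MemHardy.ae_tendsto_radialLimit {f : ℂ → ℂ} (hf : MemHardy 2 f) :
    ∀ᵐ x : ℝ, Tendsto (fun r : ℝ => f (r * circleMap 0 1 x)) (𝓝[<] 1)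
      (𝓝 (radialLimit f (circleMap 0 1 x))) := by
  obtain ⟨φ, hφ, hfφ⟩ := hf.exists_eq_poissonIntegral
  filter_upwards [ae_tendsto_poissonIntegral hφ] with x hx
  refine tendsto_nhds_limUnder ⟨_, hx.congr' ?_⟩
  filter_upwards [Ioo_mem_nhdsLT (show (0 : ℝ) < 1 by norm_num)] with r hr
  exact (hfφ _ (mul_circleMap_mem_ball hr x)).symm

/-! ### Outer functions: modulus, Jensen's inequality and square means -/

lemma circleMap_zero_eq_mul (r x : ℝ) : circleMap 0 r x = r * circleMap 0 1 x := by
  simp [circleMap]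

lemma CircleIntegrable.ofReal_complex {h : ℂ → ℝ} (hh : CircleIntegrable h 0 1) :
    CircleIntegrable (fun ζ => (h ζ : ℂ)) 0 1 := by
  simp only [CircleIntegrable, intervalIntegrable_iff] at hh ⊢
  exact Complex.ofRealCLM.integrable_comp hh

lemma circleIntegrable_herglotz_mul {h : ℂ → ℝ} (hh : CircleIntegrable h 0 1) {z : ℂ}
    (hz : z ∈ ball (0 : ℂ) 1) :
    CircleIntegrable (fun ζ => (ζ + z) / (ζ - z) * (h ζ : ℂ)) 0 1 := by
  have := hh.ofReal_complex.continuousOn_smul (continuousOn_herglotzRieszKernel_sphere hz)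
  simpa [herglotzRieszKernel_fun_def, Pi.mul_def] using this

lemma differentiableOn_outerExp {h : ℂ → ℝ} (hh : CircleIntegrable h 0 1) :
    DifferentiableOn ℂ (outerExp h) (ball 0 1) := by
  have := differentiableOn_circleAverage_herglotzRieszKernel_smul hh.ofReal_complex
  simp only [herglotzRieszKernel_def, sub_zero, smul_eq_mul] at this
  exact this.cexp

lemma norm_outerExp {h : ℂ → ℝ} (hh : CircleIntegrable h 0 1) {z : ℂ}
    (hz : z ∈ ball (0 : ℂ) 1) : ‖outerExp h z‖ = exp (poissonIntegral h z) := by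
  have := re_circleAverage_herglotzRieszKernel_smul hh hz
  simp only [herglotzRieszKernel_def, sub_zero, smul_eq_mul] at this
  rw [outerExp, Complex.norm_exp, this, poissonIntegral, poissonKernel_eq_re_herglotzRieszKernel]
  rfl

lemma outerExp_add {h k : ℂ → ℝ} (hh : CircleIntegrable h 0 1) (hk : CircleIntegrable k 0 1)
    {z : ℂ} (hz : z ∈ ball (0 : ℂ) 1) :
    outerExp (fun ζ => h ζ + k ζ) z = outerExp h z * outerExp k z := by
  rw [outerExp, outerExp, outerExp, ← Complex.exp_add, ← circleAverage_fun_add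
    (circleIntegrable_herglotz_mul hh hz) (circleIntegrable_herglotz_mul hk hz)]
  simp only [Complex.ofReal_add, mul_add]

lemma outerExp_congr_ae {h k : ℂ → ℝ}
    (hhk : ∀ᵐ x : ℝ, h (circleMap 0 1 x) = k (circleMap 0 1 x)) : outerExp h = outerExp k := by
  ext z
  rw [outerExp, outerExp, circleAverage_def, circleAverage_def]
  congr 2
  refine intervalIntegral.integral_congr_ae ?_
  filter_upwards [hhk] with x hx _
  rw [hx]

lemma poissonIntegral_mono {h k : ℂ → ℝ} (hh : CircleIntegrable h 0 1)
    (hk : CircleIntegrable k 0 1) (hhk : ∀ ζ, h ζ ≤ k ζ) {z : ℂ} (hz : z ∈ ball (0 : ℂ) 1) :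
    poissonIntegral h z ≤ poissonIntegral k z := by
  refine circleAverage_mono (circleIntegrable_poissonKernel_smul hh hz)
    (circleIntegrable_poissonKernel_smul hk hz) fun ζ hζ => ?_
  exact mul_le_mul_of_nonneg_left (hhk ζ) (poissonKernel_nonneg hz (by simpa using hζ))

lemma norm_outerExp_mono {h k : ℂ → ℝ} (hh : CircleIntegrable h 0 1)
    (hk : CircleIntegrable k 0 1) (hhk : ∀ ζ, h ζ ≤ k ζ) {z : ℂ} (hz : z ∈ ball (0 : ℂ) 1) :
    ‖outerExp h z‖ ≤ ‖outerExp k z‖ := by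
  rw [norm_outerExp hh hz, norm_outerExp hk hz]
  exact exp_le_exp.2 (poissonIntegral_mono hh hk hhk hz)

lemma ae_tendsto_norm_outerExp {h : ℂ → ℝ} (hh : CircleIntegrable h 0 1) :
    ∀ᵐ x : ℝ, Tendsto (fun r : ℝ => ‖outerExp h (r * circleMap 0 1 x)‖) (𝓝[<] 1)
      (𝓝 (exp (h (circleMap 0 1 x)))) := by
  filter_upwards [ae_tendsto_poissonIntegral hh] with x hx
  refine ((continuous_exp.tendsto _).comp hx).congr' ?_
  filter_upwards [Ioo_mem_nhdsLT (show (0 : ℝ) < 1 by norm_num)] with r hr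
  rw [norm_outerExp hh (mul_circleMap_mem_ball hr x)]
  rfl

/-- Jensen's inequality for the Poisson integral. -/
lemma exp_poissonIntegral_le {h : ℂ → ℝ} (hh : CircleIntegrable h 0 1)
    (he : CircleIntegrable (fun ζ => exp (h ζ)) 0 1) {z : ℂ} (hz : z ∈ ball (0 : ℂ) 1) :
    exp (poissonIntegral h z) ≤ poissonIntegral (fun ζ => exp (h ζ)) z := by
  set m := poissonIntegral h z with hm
  have h1 : CircleIntegrable (fun ζ => exp m * h ζ) 0 1 := hh.const_smul (a := exp m)
  have h2 : CircleIntegrable (fun _ : ℂ => exp m * (1 - m)) 0 1 := circleIntegrable_const _ _ _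
  -- The tangent line to `exp` at `m` lies below `exp`; integrate it against the kernel.
  have key := poissonIntegral_mono (h1.add h2) he (fun ζ => by
    have := mul_le_mul_of_nonneg_left (add_one_le_exp (h ζ - m)) (exp_pos m).le
    rw [← exp_add] at this
    simp only [add_sub_cancel] at this
    simp only [Pi.add_apply]
    linarith) hz
  refine le_of_eq_of_le ?_ key
  have e : poissonIntegral ((fun ζ => exp m * h ζ) + fun _ : ℂ => exp m * (1 - m)) z =
      exp m * m + exp m * (1 - m) := by
    conv_rhs => rw [← poissonIntegral_const (exp m * (1 - m)) hz]
    rw [poissonIntegral, poissonIntegral]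
    simp only [Pi.add_apply, smul_add]
    rw [circleAverage_fun_add (circleIntegrable_poissonKernel_smul h1 hz)
      (circleIntegrable_poissonKernel_smul h2 hz)]
    congr 1
    rw [hm, poissonIntegral, ← smul_eq_mul (exp _) (circleAverage _ _ _), ← circleAverage_fun_smul]
    congr 1
    ext ζ
    simp only [smul_eq_mul]
    ring
  rw [e]
  ring

/-- Exchanging the two angles preserves the distance. This makes the kernel have mean one in either
angle, as Tonelli requires in `lintegral_poissonIntegral`. -/
lemma poissonKernel_circleMap_comm {r : ℝ} (x t : ℝ) :
    poissonKernel 0 (r * circleMap 0 1 x) (circleMap 0 1 t) =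
      poissonKernel 0 (r * circleMap 0 1 t) (circleMap 0 1 x) := by
  have h : ‖circleMap 0 1 t - r * circleMap 0 1 x‖ ^ 2 =
      ‖circleMap 0 1 x - r * circleMap 0 1 t‖ ^ 2 := by
    rw [← Complex.real_smul, ← Complex.real_smul, norm_sub_sq_real, norm_sub_sq_real,
      real_inner_smul_right, real_inner_smul_right, real_inner_comm]
    simp
  simp only [poissonKernel_def, sub_zero, h]
  simp

lemma ofReal_circleAverage_eq_lintegral {φ : ℂ → ℝ} {r : ℝ} (hφ : CircleIntegrable φ 0 r)
    (h0 : ∀ x, 0 ≤ φ (circleMap 0 r x)) :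
    ENNReal.ofReal (circleAverage φ 0 r) = ENNReal.ofReal (2 * π)⁻¹ *
      ∫⁻ x in Ioc 0 (2 * π), ENNReal.ofReal (φ (circleMap 0 r x)) := by
  rw [CircleIntegrable, intervalIntegrable_iff_integrableOn_Ioc_of_le (by positivity)] at hφ
  rw [circleAverage_def, smul_eq_mul, ENNReal.ofReal_mul (by positivity),
    intervalIntegral.integral_of_le (by positivity),
    ofReal_integral_eq_lintegral_ofReal hφ (Eventually.of_forall h0)]

lemma lintegral_poissonIntegral {φ : ℂ → ℝ} (hφ : CircleIntegrable φ 0 1) (h0 : ∀ ζ, 0 ≤ φ ζ)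
    {r : ℝ} (hr : r ∈ Ioo (0 : ℝ) 1) :
    ∫⁻ x in Ioc 0 (2 * π), ENNReal.ofReal (poissonIntegral φ (r * circleMap 0 1 x)) =
      ∫⁻ t in Ioc 0 (2 * π), ENNReal.ofReal (φ (circleMap 0 1 t)) := by
  have hK : Measurable fun p : ℝ × ℝ =>
      ENNReal.ofReal (poissonKernel 0 (r * circleMap 0 1 p.1) (circleMap 0 1 p.2)) := by
    simp only [poissonKernel_def]
    fun_prop
  have hm : AEMeasurable (fun t => ENNReal.ofReal (φ (circleMap 0 1 t)))
      (volume.restrict (Ioc 0 (2 * π))) := by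
    rw [CircleIntegrable, intervalIntegrable_iff_integrableOn_Ioc_of_le (by positivity)] at hφ
    exact hφ.aemeasurable.ennreal_ofReal
  have h1 : ∀ x, ENNReal.ofReal (poissonIntegral φ (r * circleMap 0 1 x)) =
      ENNReal.ofReal (2 * π)⁻¹ * ∫⁻ t in Ioc 0 (2 * π),
        ENNReal.ofReal (poissonKernel 0 (r * circleMap 0 1 x) (circleMap 0 1 t)) *
          ENNReal.ofReal (φ (circleMap 0 1 t)) := by
    intro x
    have hz := mul_circleMap_mem_ball hr x
    rw [poissonIntegral, ofReal_circleAverage_eq_lintegral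
      (circleIntegrable_poissonKernel_smul hφ hz) fun t =>
        mul_nonneg (poissonKernel_nonneg hz (by simp)) (h0 _)]
    congr 2 with t
    rw [smul_eq_mul, ENNReal.ofReal_mul (poissonKernel_nonneg hz (by simp))]
  have h2 : ∀ t, ENNReal.ofReal (2 * π)⁻¹ * ∫⁻ x in Ioc 0 (2 * π),
      ENNReal.ofReal (poissonKernel 0 (r * circleMap 0 1 x) (circleMap 0 1 t)) = 1 := by
    intro t
    have hz := mul_circleMap_mem_ball hr t
    simp only [poissonKernel_circleMap_comm _ t]
    have hc := continuousOn_poissonKernel_sphere hz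
    rw [abs_one] at hc
    rw [← ofReal_circleAverage_eq_lintegral (hc.circleIntegrable zero_le_one)
      fun t => poissonKernel_nonneg hz (by simp), circleAverage_poissonKernel hz,
      ENNReal.ofReal_one]
  simp only [h1]
  rw [lintegral_const_mul' _ _ ENNReal.ofReal_ne_top, lintegral_lintegral_swap
    (hK.aemeasurable.mul hm.comp_snd), ← lintegral_const_mul' _ _ ENNReal.ofReal_ne_top]
  congr with t
  rw [lintegral_mul_const' _ _ ENNReal.ofReal_ne_top, ← mul_assoc, h2, one_mul]

lemma lintegral_norm_sq_outerExp_le {c : ℂ → ℝ} (hc : CircleIntegrable c 0 1)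
    (he : CircleIntegrable (fun ζ => exp (2 * c ζ)) 0 1) {r : ℝ} (hr : r ∈ Ioo (0 : ℝ) 1) :
    ∫⁻ x in Ioc 0 (2 * π), ENNReal.ofReal (‖outerExp c (r * circleMap 0 1 x)‖ ^ 2) ≤
      ∫⁻ t in Ioc 0 (2 * π), ENNReal.ofReal (exp (2 * c (circleMap 0 1 t))) := by
  rw [← lintegral_poissonIntegral he (fun _ => (exp_pos _).le) hr]
  refine lintegral_mono fun x => ENNReal.ofReal_le_ofReal ?_
  have hz := mul_circleMap_mem_ball hr x
  have h2 : CircleIntegrable (fun ζ => 2 * c ζ) 0 1 := hc.const_smul (a := (2 : ℝ))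
  refine le_of_eq_of_le ?_ (exp_poissonIntegral_le h2 he hz)
  have e : poissonIntegral (fun ζ => 2 * c ζ) (r * circleMap 0 1 x) =
      2 * poissonIntegral c (r * circleMap 0 1 x) := by
    rw [poissonIntegral, poissonIntegral, ← smul_eq_mul 2 (circleAverage _ _ _),
      ← circleAverage_fun_smul]
    congr 1
    ext ζ
    simp only [smul_eq_mul]
    ring
  rw [norm_outerExp hc hz, ← exp_nat_mul, e]
  norm_num

lemma continuous_outerExp_circle {c : ℂ → ℝ} (hc : CircleIntegrable c 0 1) {r : ℝ}
    (hr : r ∈ Ioo (0 : ℝ) 1) : Continuous fun x : ℝ => outerExp c (r * circleMap 0 1 x) :=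
  (differentiableOn_outerExp hc).continuousOn.comp_continuous (by fun_prop)
    (mul_circleMap_mem_ball hr)

lemma lintegral_exp_le_liminf {c : ℂ → ℝ} (hc : CircleIntegrable c 0 1) {u : ℕ → ℝ}
    (hu : ∀ᶠ n in atTop, u n ∈ Ioo (0 : ℝ) 1) (hlim : Tendsto u atTop (𝓝[<] 1)) :
    ∫⁻ t in Ioc 0 (2 * π), ENNReal.ofReal (exp (2 * c (circleMap 0 1 t))) ≤
      liminf (fun n => ∫⁻ x in Ioc 0 (2 * π),
        ENNReal.ofReal (‖outerExp c (u n * circleMap 0 1 x)‖ ^ 2)) atTop := by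
  obtain ⟨N, hN⟩ := eventually_atTop.1 hu
  rw [← liminf_nat_add _ N]
  refine le_trans (lintegral_mono_ae ?_) (lintegral_liminf_le' fun n => ?_)
  · filter_upwards [ae_restrict_of_ae (ae_tendsto_norm_outerExp hc)] with x hx
    have h1 := (hx.comp hlim).pow 2
    rw [← exp_nat_mul] at h1
    have h2 := (ENNReal.tendsto_ofReal h1).comp (tendsto_add_atTop_nat N)
    exact_mod_cast h2.liminf_eq.ge
  · exact (((continuous_outerExp_circle hc (hN (n + N) (by omega))).norm.pow
      2).measurable.ennreal_ofReal).aemeasurable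

/-- The square means of an outer function converge to those of its boundary modulus. -/
lemma tendsto_circleAverage_norm_sq_outerExp {c : ℂ → ℝ} (hc : CircleIntegrable c 0 1)
    (he : CircleIntegrable (fun ζ => exp (2 * c ζ)) 0 1) :
    Tendsto (fun r => circleAverage (fun z => ‖outerExp c z‖ ^ 2) 0 r) (𝓝[<] 1)
      (𝓝 (circleAverage (fun ζ => exp (2 * c ζ)) 0 1)) := by
  refine tendsto_of_seq_tendsto fun u hu => ?_
  have hev : ∀ᶠ n in atTop, u n ∈ Ioo (0 : ℝ) 1 :=
    hu (Ioo_mem_nhdsLT (show (0 : ℝ) < 1 by norm_num))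
  have h1 : Tendsto (fun n => ∫⁻ x in Ioc 0 (2 * π),
        ENNReal.ofReal (‖outerExp c (u n * circleMap 0 1 x)‖ ^ 2)) atTop
      (𝓝 (∫⁻ t in Ioc 0 (2 * π), ENNReal.ofReal (exp (2 * c (circleMap 0 1 t))))) := by
    -- Fatou's lemma gives the lower bound, Jensen's inequality the upper one.
    refine tendsto_of_le_liminf_of_limsup_le (lintegral_exp_le_liminf hc hev hu) ?_
    refine limsup_le_of_le (by isBoundedDefault) ?_
    filter_upwards [hev] with n hn using lintegral_norm_sq_outerExp_le hc he hn
  have h2 := ENNReal.Tendsto.const_mul (a := ENNReal.ofReal (2 * π)⁻¹) h1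
    (Or.inr ENNReal.ofReal_ne_top)
  rw [← ofReal_circleAverage_eq_lintegral he fun _ => (exp_pos _).le] at h2
  have h3 := (ENNReal.tendsto_toReal ENNReal.ofReal_ne_top).comp h2
  rw [ENNReal.toReal_ofReal (circleAverage_nonneg_of_nonneg fun _ _ => (exp_pos _).le)] at h3
  refine h3.congr' ?_
  filter_upwards [hev] with n hn
  have h4 : CircleIntegrable (fun z => ‖outerExp c z‖ ^ 2) 0 (u n) := by
    refine ContinuousOn.circleIntegrable hn.1.le ?_
    refine ((differentiableOn_outerExp hc).continuousOn.mono fun z hz => ?_).norm.pow 2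
    rw [mem_sphere_zero_iff_norm] at hz
    rw [mem_ball_zero_iff, hz]
    exact hn.2
  have h5 := ofReal_circleAverage_eq_lintegral h4 fun _ => by positivity
  simp only [circleMap_zero_eq_mul (u n)] at h5
  rw [Function.comp_apply, ← h5, ENNReal.toReal_ofReal (circleAverage_nonneg_of_nonneg
    fun _ _ => by positivity)]
  rfl

/-- The boundary data of an outer function in `H²`. -/
lemma IsOuter.exists_boundary {f : ℂ → ℂ} (hf : IsOuter f) (hf2 : MemHardy 2 f) :
    ∃ (α : ℂ) (a : ℂ → ℝ), ‖α‖ = 1 ∧ CircleIntegrable a 0 1 ∧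
      CircleIntegrable (fun ζ => exp (2 * a ζ)) 0 1 ∧
      (∀ z ∈ ball (0 : ℂ) 1, f z = α * outerExp a z) ∧
      (∀ᵐ x : ℝ, ‖radialLimit f (circleMap 0 1 x)‖ = exp (a (circleMap 0 1 x))) ∧
      ∀ᵐ x : ℝ, ‖radialLimit (fun z => f z ^ 2) (circleMap 0 1 x)‖ =
        exp (2 * a (circleMap 0 1 x)) := by
  obtain ⟨-, α, a, hα, ha, hfa⟩ := hf
  have hnorm : ∀ᵐ x : ℝ, ‖radialLimit f (circleMap 0 1 x)‖ = exp (a (circleMap 0 1 x)) := by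
    filter_upwards [hf2.ae_tendsto_radialLimit, ae_tendsto_norm_outerExp ha] with x h1 h2
    refine tendsto_nhds_unique (h1.norm.congr' ?_) h2
    filter_upwards [Ioo_mem_nhdsLT (show (0 : ℝ) < 1 by norm_num)] with r hr
    rw [hfa _ (mul_circleMap_mem_ball hr x), norm_mul, hα, one_mul]
  refine ⟨α, a, hα, ha, ?_, hfa, hnorm, ?_⟩
  · obtain ⟨hd, C, hC⟩ := hf2
    obtain ⟨u, -, hu1, hu⟩ := exists_seq_strictMono_tendsto' (show (0 : ℝ) < 1 by norm_num)
    have hlim : Tendsto u atTop (𝓝[<] 1) :=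
      tendsto_nhdsWithin_iff.2 ⟨hu, Eventually.of_forall fun n => (hu1 n).2⟩
    -- Fatou's lemma along radii tending to 1 turns the bound on the square means into integrability
    -- of the squared boundary modulus.
    have h1 := lintegral_exp_le_liminf ha (Eventually.of_forall hu1) hlim
    rw [CircleIntegrable, intervalIntegrable_iff_integrableOn_Ioc_of_le (by positivity)] at ha ⊢
    refine ⟨(continuous_exp.comp_aestronglyMeasurable (ha.1.const_mul 2)), ?_⟩
    rw [hasFiniteIntegral_iff_ofReal (Eventually.of_forall fun _ => (exp_pos _).le)]
    refine h1.trans_lt (lt_of_le_of_lt (liminf_le_of_le (by isBoundedDefault)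
      (a := ENNReal.ofReal (2 * π * C)) fun b hb => ?_) ENNReal.ofReal_lt_top)
    obtain ⟨n, hn⟩ := hb.exists
    refine hn.trans ?_
    have h4 : CircleIntegrable (fun z => ‖f z‖ ^ (2 : ℝ)) 0 (u n) := by
      refine ContinuousOn.circleIntegrable (hu1 n).1.le ?_
      refine (hd.continuousOn.mono fun z hz => ?_).norm.rpow_const (by norm_num)
      rw [mem_sphere_zero_iff_norm] at hz
      rw [mem_ball_zero_iff, hz]
      exact (hu1 n).2
    have h5 := ofReal_circleAverage_eq_lintegral h4 fun _ => by positivity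
    have h6 : ∫⁻ x in Ioc 0 (2 * π), ENNReal.ofReal (‖outerExp a (u n * circleMap 0 1 x)‖ ^ 2) =
        ENNReal.ofReal (2 * π) *
          ENNReal.ofReal (circleAverage (fun z => ‖f z‖ ^ (2 : ℝ)) 0 (u n)) := by
      rw [h5, ← mul_assoc, ← ENNReal.ofReal_mul (by positivity), mul_inv_cancel₀ (by positivity),
        ENNReal.ofReal_one, one_mul]
      congr with x
      rw [circleMap_zero_eq_mul (u n), hfa _ (mul_circleMap_mem_ball (hu1 n) x), norm_mul, hα, one_mul]
      norm_num
    rw [h6, ← ENNReal.ofReal_mul (by positivity)]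
    gcongr
    exact hC _ (hu1 n)
  · filter_upwards [hnorm, hf2.ae_tendsto_radialLimit] with x h1 h2
    have h3 : radialLimit (fun z => f z ^ 2) (circleMap 0 1 x) =
        radialLimit f (circleMap 0 1 x) ^ 2 := (h2.pow 2).limUnder_eq
    rw [h3, norm_pow, h1, ← exp_nat_mul]
    norm_num

/-! ### Circle means and the discrete Laplacian -/

/-- The integral of an extended nonnegative function over the circle of centre `a` and radius `δ`,
with respect to the angle. -/
noncomputable def circleLIntegral (v : ℂ → ℝ≥0∞) (a : ℂ) (δ : ℝ) : ℝ≥0∞ :=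
  ∫⁻ θ in Ioc 0 (2 * π), v (circleMap a δ θ)

lemma circleLIntegral_eq_setLIntegral (v : ℂ → ℝ≥0∞) (a : ℂ) (δ t : ℝ) :
    circleLIntegral v a δ = ∫⁻ θ in Ioc t (t + 2 * π), v (circleMap a δ θ) := by
  have h0 := isAddFundamentalDomain_Ioc (T := 2 * π) (by positivity) 0
  have h1 := isAddFundamentalDomain_Ioc (T := 2 * π) (by positivity) t
  have := h0.setLIntegral_eq h1 (fun θ => v (circleMap a δ θ)) fun g x => by
    obtain ⟨_, k, rfl⟩ := g
    have := (periodic_circleMap a δ).int_mul k x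
    simp only [AddSubgroup.vadd_def, vadd_eq_add, zsmul_eq_mul]
    rw [add_comm, this]
  rwa [zero_add] at this

/-- Changing the sign of the radius is a half-turn. It is needed because the translation `b = a +
δe^{iθ}` replaces the radius by its opposite. -/
lemma circleLIntegral_neg (v : ℂ → ℝ≥0∞) (a : ℂ) (δ : ℝ) :
    circleLIntegral v a (-δ) = circleLIntegral v a δ := by
  rw [circleLIntegral_eq_setLIntegral v a δ π, circleLIntegral]
  have := (measurePreserving_add_right (volume : Measure ℝ) π).setLIntegral_comp_preimage_emb
    (measurableEmbedding_addRight π) (fun θ => v (circleMap a δ θ)) (Ioc π (π + 2 * π))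
  rw [← this]
  have e : (fun x => x + π) ⁻¹' Ioc π (π + 2 * π) = Ioc 0 (2 * π) := by
    rw [preimage_add_const_Ioc]
    congr 1 <;> ring
  rw [e]
  simp only [circleMap_neg_radius]

/-- Averaging over circles of a fixed radius is symmetric. -/
lemma lintegral_mul_circleLIntegral_comm {S W : ℂ → ℝ≥0∞} (hS : Measurable S) (hW : Measurable W)
    (δ : ℝ) :
    ∫⁻ a, W a * circleLIntegral S a δ = ∫⁻ b, S b * circleLIntegral W b δ := by
  have hc : Measurable fun p : ℂ × ℝ => circleMap p.1 δ p.2 := by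
    unfold circleMap; fun_prop
  have hc2 : Measurable fun p : ℝ × ℂ => circleMap p.2 (-δ) p.1 := by
    unfold circleMap; fun_prop
  calc ∫⁻ a, W a * circleLIntegral S a δ
      = ∫⁻ a, ∫⁻ θ in Ioc 0 (2 * π), W a * S (circleMap a δ θ) := by
        congr with a
        rw [circleLIntegral, lintegral_const_mul]
        exact hS.comp (by fun_prop)
    _ = ∫⁻ θ in Ioc 0 (2 * π), ∫⁻ a, W a * S (circleMap a δ θ) := by
        rw [lintegral_lintegral_swap]
        exact ((hW.comp measurable_fst).mul (hS.comp hc)).aemeasurable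
    _ = ∫⁻ θ in Ioc 0 (2 * π), ∫⁻ b, S b * W (circleMap b (-δ) θ) := by
        congr with θ
        rw [← lintegral_add_right_eq_self (fun b => S b * W (circleMap b (-δ) θ))
          (circleMap 0 δ θ)]
        congr with a
        rw [mul_comm]
        congr 2 <;> simp [circleMap]
    _ = ∫⁻ b, ∫⁻ θ in Ioc 0 (2 * π), S b * W (circleMap b (-δ) θ) := by
        rw [lintegral_lintegral_swap]
        exact ((hS.comp measurable_snd).mul (hW.comp hc2)).aemeasurable
    _ = ∫⁻ b, S b * circleLIntegral W b δ := by
        congr with b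
        rw [← circleLIntegral_neg, circleLIntegral, lintegral_const_mul]
        exact hW.comp (by fun_prop)

/-- The integral of `|slope u|²` over the circle of centre `a` and radius `δ`. -/
noncomputable def circleSlope (u : ℂ → ℂ) (δ : ℝ) (a : ℂ) : ℝ≥0∞ :=
  circleLIntegral (fun b => ‖slope u a b‖ₑ ^ 2) a δ

lemma measurable_circleSlope {u : ℂ → ℂ} (hu : Measurable u) (δ : ℝ) :
    Measurable (circleSlope u δ) := by
  unfold circleSlope circleLIntegral
  refine Measurable.lintegral_prod_right' (f := fun p : ℂ × ℝ =>
    ‖slope u p.1 (circleMap p.1 δ p.2)‖ₑ ^ 2) ?_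
  simp only [slope_def_field, circleMap]
  fun_prop

lemma enorm_sq_eq_ofReal (z : ℂ) : ‖z‖ₑ ^ 2 = ENNReal.ofReal (‖z‖ ^ 2) := by
  rw [ENNReal.ofReal_pow (norm_nonneg z), ofReal_norm]

lemma circleLIntegral_const (c : ℝ≥0∞) (a : ℂ) (δ : ℝ) :
    circleLIntegral (fun _ => c) a δ = ENNReal.ofReal (2 * π) * c := by
  rw [circleLIntegral, lintegral_const, Measure.restrict_apply_univ, Real.volume_Ioc, sub_zero,
    mul_comm]

lemma circleLIntegral_mono {v w : ℂ → ℝ≥0∞} {a : ℂ} {δ : ℝ}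
    (h : ∀ θ, v (circleMap a δ θ) ≤ w (circleMap a δ θ)) :
    circleLIntegral v a δ ≤ circleLIntegral w a δ :=
  lintegral_mono h

lemma circleLIntegral_congr {v w : ℂ → ℝ≥0∞} {a : ℂ} {δ : ℝ}
    (h : ∀ θ, v (circleMap a δ θ) = w (circleMap a δ θ)) :
    circleLIntegral v a δ = circleLIntegral w a δ :=
  lintegral_congr h

/-- An exact discrete form of `Δ|u|² = 4|u'|²`: expand `|u(a) + (u(b) - u(a))|²`; the cross term
integrates to zero by the mean value property. -/
lemma circleLIntegral_enorm_sq {u : ℂ → ℂ} {a : ℂ} {δ : ℝ} (hδ : 0 < δ)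
    (hu : DifferentiableOn ℂ u (closedBall a δ)) :
    circleLIntegral (fun b => ‖u b‖ₑ ^ 2) a δ =
      ENNReal.ofReal (2 * π) * ‖u a‖ₑ ^ 2 + ENNReal.ofReal δ ^ 2 * circleSlope u δ a := by
  have hcl : DiffContOnCl ℂ u (ball a |δ|) := by
    rw [abs_of_pos hδ]
    refine hu.diffContOnCl_ball subset_rfl
  have hmean := hcl.circleAverage
  have hcont : Continuous fun θ => u (circleMap a δ θ) :=
    hu.continuousOn.comp_continuous (by fun_prop) fun θ => circleMap_mem_closedBall a hδ.le θ
  rw [circleAverage_def, intervalIntegral.integral_of_le (by positivity)] at hmean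
  set g : ℝ → ℂ := fun θ => u (circleMap a δ θ) with hg
  set c := u a
  have hi : ∀ {F : Type} [NormedAddCommGroup F] {k : ℝ → F}, Continuous k →
      IntegrableOn k (Ioc 0 (2 * π)) := fun hk => (hk.integrableOn_Icc).mono_set Ioc_subset_Icc_self
  have hzero : ∫ θ in Ioc 0 (2 * π), (g θ - c) = 0 := by
    rw [integral_sub (hi hcont) (hi continuous_const), ← hmean]
    simp only [integral_const, measureReal_restrict_apply MeasurableSet.univ, univ_inter,
      Real.volume_real_Ioc_of_le two_pi_pos.le, sub_zero]
    rw [smul_smul, mul_inv_cancel₀ (by positivity), one_smul, sub_self]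
  have hreal : ∫ θ in Ioc 0 (2 * π), ‖g θ‖ ^ 2 =
      2 * π * ‖c‖ ^ 2 + ∫ θ in Ioc 0 (2 * π), ‖g θ - c‖ ^ 2 := by
    have e : ∀ θ, ‖g θ‖ ^ 2 = ‖c‖ ^ 2 + 2 * inner ℝ c (g θ - c) + ‖g θ - c‖ ^ 2 := fun θ => by
      rw [← norm_add_sq_real, add_sub_cancel]
    have h1 : Continuous fun θ => 2 * inner ℝ c (g θ - c) := by fun_prop
    simp only [e]
    rw [integral_add (hi (by fun_prop)) (hi (by fun_prop)),
      integral_add (hi (by fun_prop)) (hi h1), integral_const_mul,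
      integral_inner (hi (by fun_prop)), hzero, inner_zero_right, mul_zero, add_zero]
    simp only [integral_const, measureReal_restrict_apply MeasurableSet.univ, univ_inter,
      Real.volume_real_Ioc_of_le two_pi_pos.le, sub_zero, smul_eq_mul]
  have hslope : ∀ θ, ENNReal.ofReal δ ^ 2 * ‖slope u a (circleMap a δ θ)‖ₑ ^ 2 =
      ENNReal.ofReal (‖g θ - c‖ ^ 2) := fun θ => by
    rw [← enorm_sq_eq_ofReal, ← mul_pow, slope_def_field]
    congr 1
    have h1 : circleMap a δ θ - a ≠ 0 := by
      rw [circleMap_sub_center, circleMap_zero]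
      simpa using hδ.ne'
    have h2 : ENNReal.ofReal δ = ‖circleMap a δ θ - a‖ₑ := by
      rw [← ofReal_norm]
      simp [abs_of_pos hδ]
    rw [h2, ← enorm_mul, mul_div_cancel₀ _ h1]
  rw [circleSlope, circleLIntegral, circleLIntegral,
    ← lintegral_const_mul' _ _ (by finiteness)]
  simp only [hslope]
  simp only [enorm_sq_eq_ofReal]
  change ∫⁻ θ in Ioc 0 (2 * π), ENNReal.ofReal (‖g θ‖ ^ 2) = _
  rw [← ofReal_integral_eq_lintegral_ofReal (hi (by fun_prop))
      (Eventually.of_forall fun _ => by positivity),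
    ← ofReal_integral_eq_lintegral_ofReal (hi (by fun_prop))
      (Eventually.of_forall fun _ => by positivity), ← ENNReal.ofReal_mul (by positivity),
    ← ENNReal.ofReal_add (by positivity) (integral_nonneg fun _ => by positivity), ← hreal]

lemma exists_norm_slope_le {u : ℂ → ℂ} (hu : DifferentiableOn ℂ u (ball 0 1)) {R : ℝ}
    (hR : R < 1) :
    ∃ C : ℝ, 0 ≤ C ∧ ∀ a ∈ closedBall (0 : ℂ) R, ∀ b ∈ closedBall (0 : ℂ) R,
      ‖slope u a b‖ ≤ C := by
  have hsub : closedBall (0 : ℂ) R ⊆ ball 0 1 := closedBall_subset_ball hR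
  obtain ⟨C, hC⟩ := (isCompact_closedBall (0 : ℂ) R).exists_bound_of_continuousOn
    ((hu.deriv isOpen_ball).continuousOn.mono hsub)
  refine ⟨max C 0, le_max_right _ _, fun a ha b hb => ?_⟩
  have h := (convex_closedBall (0 : ℂ) R).norm_image_sub_le_of_norm_deriv_le (f := u) (C := max C 0)
    (fun x hx => hu.differentiableAt (isOpen_ball.mem_nhds (hsub hx)))
    (fun x hx => (hC x hx).trans (le_max_left _ _)) ha hb
  rw [slope_def_field, norm_div]
  exact div_le_of_le_mul₀ (norm_nonneg _) (le_max_right _ _) h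

lemma circleMap_mem_closedBall_of_mem {a : ℂ} {r δ : ℝ} (ha : a ∈ closedBall (0 : ℂ) r)
    (hδ : 0 ≤ δ) (θ : ℝ) : circleMap a δ θ ∈ closedBall (0 : ℂ) (r + δ) := by
  have h1 := circleMap_mem_closedBall a hδ θ
  rw [mem_closedBall] at *
  linarith [dist_triangle (circleMap a δ θ) a 0]

lemma tendsto_circleSlope {u : ℂ → ℂ} (hm : Measurable u)
    (hu : DifferentiableOn ℂ u (ball 0 1)) {a : ℂ} (ha : a ∈ ball (0 : ℂ) 1) :
    Tendsto (fun δ => circleSlope u δ a) (𝓝[>] 0)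
      (𝓝 (ENNReal.ofReal (2 * π) * ‖deriv u a‖ₑ ^ 2)) := by
  have ha' : ‖a‖ < 1 := by simpa using ha
  obtain ⟨C, hC0, hC⟩ := exists_norm_slope_le hu (R := (‖a‖ + 1) / 2) (by linarith)
  have e : ENNReal.ofReal (2 * π) * ‖deriv u a‖ₑ ^ 2 =
      ∫⁻ _ in Ioc 0 (2 * π), ‖deriv u a‖ₑ ^ 2 := (circleLIntegral_const _ 0 0).symm
  rw [e]
  refine tendsto_lintegral_filter_of_dominated_convergence (fun _ => ENNReal.ofReal C ^ 2) ?_ ?_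
    ?_ ?_
  · refine Eventually.of_forall fun δ => ?_
    simp only [slope_def_field, circleMap]
    fun_prop
  · filter_upwards [Ioo_mem_nhdsGT (show 0 < (1 - ‖a‖) / 2 by linarith)] with δ hδ
    refine Eventually.of_forall fun θ => ?_
    have h1 := circleMap_mem_closedBall_of_mem (r := ‖a‖) (by simp) hδ.1.le θ (a := a)
    have h2 := hC a (by simp; linarith) (circleMap a δ θ)
      (closedBall_subset_closedBall (by linarith [hδ.2]) h1)
    gcongr
    rw [← ofReal_norm]
    exact ENNReal.ofReal_le_ofReal h2
  · rw [lintegral_const, Measure.restrict_apply_univ, Real.volume_Ioc]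
    finiteness
  · refine Eventually.of_forall fun θ => ?_
    have hd := (hu.differentiableAt (isOpen_ball.mem_nhds ha)).hasDerivAt.tendsto_slope
    have hc : Tendsto (fun δ : ℝ => circleMap a δ θ) (𝓝[>] 0) (𝓝[≠] a) := by
      refine tendsto_nhdsWithin_iff.2 ⟨?_, ?_⟩
      · have : Continuous fun δ : ℝ => circleMap a δ θ := by unfold circleMap; fun_prop
        have h := this.tendsto 0
        rw [circleMap_zero_radius] at h
        exact h.mono_left nhdsWithin_le_nhds
      · filter_upwards [self_mem_nhdsWithin] with δ hδ
        have hδ' : (0 : ℝ) < δ := hδ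
        intro h
        have h2 : ‖circleMap a δ θ - a‖ = |δ| := by simp
        rw [mem_singleton_iff.1 h, sub_self, norm_zero] at h2
        exact hδ'.ne' (abs_eq_zero.1 h2.symm)
    exact ENNReal.Tendsto.pow (hd.comp hc).enorm

/-- Dominated convergence: on a compact subdisc the slopes are bounded uniformly in `δ`, and they
converge to the derivative. -/
lemma tendsto_lintegral_circleSlope_mul {u : ℂ → ℂ} (hm : Measurable u)
    (hu : DifferentiableOn ℂ u (ball 0 1)) {W : ℂ → ℝ≥0∞} (hW : Measurable W) {r : ℝ} (hr : r < 1)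
    (hWfin : ∫⁻ z in ball (0 : ℂ) r, W z ≠ ∞) :
    Tendsto (fun δ => ∫⁻ a in ball (0 : ℂ) r, circleSlope u δ a * W a) (𝓝[>] 0)
      (𝓝 (ENNReal.ofReal (2 * π) * ∫⁻ a in ball (0 : ℂ) r, ‖deriv u a‖ₑ ^ 2 * W a)) := by
  obtain ⟨C, hC0, hC⟩ := exists_norm_slope_le hu (R := (r + 1) / 2) (by linarith)
  rw [← lintegral_const_mul' _ _ ENNReal.ofReal_ne_top]
  simp only [← mul_assoc]
  refine tendsto_lintegral_filter_of_dominated_convergence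
    (fun z => ENNReal.ofReal (2 * π) * ENNReal.ofReal C ^ 2 * W z) ?_ ?_ ?_ ?_
  · exact Eventually.of_forall fun δ => ((measurable_circleSlope hm δ).mul hW)
  · filter_upwards [Ioo_mem_nhdsGT (show 0 < (1 - r) / 2 by linarith)] with δ hδ
    filter_upwards [ae_restrict_mem isOpen_ball.measurableSet] with a ha
    have ha' : a ∈ closedBall (0 : ℂ) r := ball_subset_closedBall ha
    gcongr
    rw [← circleLIntegral_const _ a δ]
    refine circleLIntegral_mono fun θ => ?_
    have h1 := circleMap_mem_closedBall_of_mem ha' hδ.1.le θ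
    have h2 := hC a (closedBall_subset_closedBall (by linarith) ha') (circleMap a δ θ)
      (closedBall_subset_closedBall (by linarith [hδ.2]) h1)
    gcongr
    rw [← ofReal_norm]
    exact ENNReal.ofReal_le_ofReal h2
  · rw [lintegral_const_mul' _ _ (by finiteness)]
    finiteness
  · by_cases hfin : ∀ᵐ a ∂(volume.restrict (ball (0 : ℂ) r)), W a < ∞
    · filter_upwards [ae_restrict_mem isOpen_ball.measurableSet, hfin] with a ha hWa
      exact ENNReal.Tendsto.mul_const (tendsto_circleSlope hm hu (ball_subset_ball hr.le ha))
        (Or.inr hWa.ne)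
    · exact absurd (ae_lt_top hW hWfin) hfin

lemma circleLIntegral_add {v w : ℂ → ℝ≥0∞} (hv : Measurable v) (a : ℂ) (δ : ℝ) :
    circleLIntegral (fun b => v b + w b) a δ = circleLIntegral v a δ + circleLIntegral w a δ :=
  lintegral_add_left (hv.comp (by fun_prop)) _

lemma circleLIntegral_sum {ι : Type*} [Fintype ι] {v : ι → ℂ → ℝ≥0∞} (hv : ∀ i, Measurable (v i))
    (a : ℂ) (δ : ℝ) :
    circleLIntegral (fun b => ∑ i, v i b) a δ = ∑ i, circleLIntegral (v i) a δ :=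
  lintegral_finsetSum _ fun i _ => (hv i).comp (by fun_prop)

/-! ### The truncated weight and integration over an annulus -/

/-- The truncation `min(ω, n (r² - |z|²)⁺)` of a weight. -/
noncomputable def cutoffWeight (ω : ℂ → ℝ≥0∞) (n r : ℝ) (z : ℂ) : ℝ≥0∞ :=
  min (ω z) (ENNReal.ofReal (n * (r ^ 2 - ‖z‖ ^ 2)))

lemma cutoffWeight_eq_zero (ω : ℂ → ℝ≥0∞) {n r : ℝ} (hn : 0 ≤ n) (hr : 0 ≤ r) {z : ℂ}
    (hz : r ≤ ‖z‖) : cutoffWeight ω n r z = 0 := by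
  rw [cutoffWeight, ENNReal.ofReal_of_nonpos, min_eq_right zero_le]
  have : r ^ 2 ≤ ‖z‖ ^ 2 := by gcongr
  nlinarith

/-- A minimum of superharmonic functions is superharmonic, and `n(r² - |z|²)` is superharmonic. Only
its positive part spoils this, and only for circles that can meet both sides of `|z| = r`, hence the
annulus. There `|a|² - |b|² ≤ 2δ` inside the unit disc, so the error is at most `2π · 2nδ`. -/
lemma circleLIntegral_cutoffWeight_le {ω : ℂ → ℝ≥0∞}
    (hω : ∀ a δ, 0 < δ → closedBall a δ ⊆ ball (0 : ℂ) 1 →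
      circleLIntegral ω a δ ≤ ENNReal.ofReal (2 * π) * ω a)
    {n r δ : ℝ} (hn : 0 ≤ n) (hr : 0 < r) (hδ : 0 < δ) (hrδ : r + 2 * δ < 1) (a : ℂ) :
    circleLIntegral (cutoffWeight ω n r) a δ ≤ ENNReal.ofReal (2 * π) * cutoffWeight ω n r a +
      {z : ℂ | ‖z‖ ∈ Ioo (r - δ) (r + δ)}.indicator (fun _ => ENNReal.ofReal (4 * π * n * δ)) a := by
  have hlow : ∀ θ, ‖a‖ - δ ≤ ‖circleMap a δ θ‖ := fun θ => by
    have h1 := norm_sub_norm_le a (a - circleMap a δ θ)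
    rw [sub_sub_cancel, norm_sub_rev, circleMap_sub_center, norm_circleMap_zero,
      abs_of_pos hδ] at h1
    exact h1
  have hup : ∀ θ, ‖circleMap a δ θ‖ ≤ ‖a‖ + δ := fun θ => by
    have h1 := circleMap_mem_closedBall_of_mem (r := ‖a‖) (a := a) (by simp) hδ.le θ
    simpa using h1
  rcases le_or_gt (r + δ) ‖a‖ with h | h
  · have : circleLIntegral (cutoffWeight ω n r) a δ = 0 := by
      rw [circleLIntegral_congr (w := fun _ => 0) fun θ => cutoffWeight_eq_zero ω hn hr.le
        (by linarith [hlow θ]), circleLIntegral_const, mul_zero]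
    rw [this]
    exact zero_le
  have hball : closedBall a δ ⊆ ball (0 : ℂ) 1 := fun z hz => by
    rw [mem_closedBall, dist_eq_norm] at hz
    rw [mem_ball_zero_iff]
    linarith [norm_le_norm_add_norm_sub' z a]
  have h1 : circleLIntegral (cutoffWeight ω n r) a δ ≤ ENNReal.ofReal (2 * π) * ω a :=
    (circleLIntegral_mono fun θ => min_le_left _ _).trans (hω a δ hδ hball)
  set q : ℂ → ℝ≥0∞ := fun z => ENNReal.ofReal (n * (r ^ 2 - ‖z‖ ^ 2)) with hq
  have h2 : circleLIntegral (cutoffWeight ω n r) a δ ≤ circleLIntegral q a δ :=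
    circleLIntegral_mono fun θ => min_le_right _ _
  rcases le_or_gt ‖a‖ (r - δ) with h' | h'
  · rw [indicator_of_notMem (fun hmem => by
      simp only [mem_ofPred_eq, mem_Ioo] at hmem; linarith [hmem.1]), add_zero]
    -- On this circle the positive part is inactive, so `q` is a constant minus `n|z|²`, and its
    -- mean is controlled by the submean property of `|z|²`.
    have hsum : ∀ z : ℂ, ‖z‖ ≤ r → q z + ENNReal.ofReal n * ‖z‖ₑ ^ 2 =
        ENNReal.ofReal (n * r ^ 2) := fun z hz => by
      have : ‖z‖ ^ 2 ≤ r ^ 2 := by gcongr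
      rw [hq, enorm_sq_eq_ofReal, ← ENNReal.ofReal_mul hn,
        ← ENNReal.ofReal_add (mul_nonneg hn (by linarith)) (by positivity)]
      congr 1
      ring
    have h3 : circleLIntegral q a δ +
        circleLIntegral (fun z => ENNReal.ofReal n * ‖z‖ₑ ^ 2) a δ =
          ENNReal.ofReal (2 * π) * q a +
            ENNReal.ofReal (2 * π) * (ENNReal.ofReal n * ‖a‖ₑ ^ 2) := by
      rw [← circleLIntegral_add (by fun_prop), ← mul_add, hsum a (by linarith),
        circleLIntegral_congr (w := fun _ => ENNReal.ofReal (n * r ^ 2))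
          fun θ => hsum _ (by linarith [hup θ]), circleLIntegral_const]
    have h4 : ENNReal.ofReal (2 * π) * (ENNReal.ofReal n * ‖a‖ₑ ^ 2) ≤
        circleLIntegral (fun z => ENNReal.ofReal n * ‖z‖ₑ ^ 2) a δ := by
      have := circleLIntegral_enorm_sq (u := fun z => z) (a := a) hδ differentiableOn_id
      rw [circleLIntegral, lintegral_const_mul' _ _ ENNReal.ofReal_ne_top, mul_left_comm]
      gcongr
      rw [circleLIntegral] at this
      rw [this]
      exact le_self_add
    have h5 : circleLIntegral q a δ ≤ ENNReal.ofReal (2 * π) * q a := by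
      have hfin : ENNReal.ofReal (2 * π) * (ENNReal.ofReal n * ‖a‖ₑ ^ 2) ≠ ∞ := by finiteness
      refine (ENNReal.add_le_add_iff_right hfin).1 ?_
      rw [← h3]
      gcongr
    rw [cutoffWeight, mul_min]
    exact le_min h1 (h2.trans h5)
  · rw [indicator_of_mem (show a ∈ {z : ℂ | ‖z‖ ∈ Ioo (r - δ) (r + δ)} from ⟨h', h⟩)]
    have h3 : circleLIntegral q a δ ≤
        ENNReal.ofReal (2 * π) * q a + ENNReal.ofReal (4 * π * n * δ) := by
      have e : ENNReal.ofReal (4 * π * n * δ) =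
          ENNReal.ofReal (2 * π) * ENNReal.ofReal (n * (2 * δ)) := by
        rw [← ENNReal.ofReal_mul (by positivity)]
        congr 1
        ring
      rw [e, ← mul_add, ← circleLIntegral_const _ a δ]
      refine circleLIntegral_mono fun θ => le_trans (ENNReal.ofReal_le_ofReal ?_)
        ENNReal.ofReal_add_le
      rw [← mul_add]
      refine mul_le_mul_of_nonneg_left ?_ hn
      have hb : ‖circleMap a δ θ‖ ≤ 1 := by linarith [hup θ]
      nlinarith [hlow θ, norm_nonneg a, norm_nonneg (circleMap a δ θ)]
    rw [cutoffWeight, mul_min, min_add]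
    exact le_min (h1.trans le_self_add) (h2.trans h3)

/-- Polar coordinates, with the Jacobian `ρ` bounded by 1. -/
lemma lintegral_annulus_le {σ : ℂ → ℝ≥0∞} (hσ : Measurable σ) {s t : ℝ} (ht : t ≤ 1)
    {η : ℝ≥0∞} (h : ∀ ρ ∈ Ioo s t, circleLIntegral σ 0 ρ ≤ η) :
    ∫⁻ z in {z : ℂ | ‖z‖ ∈ Ioo s t}, σ z ≤ ENNReal.ofReal (t - s) * η := by
  have hA : MeasurableSet {z : ℂ | ‖z‖ ∈ Ioo s t} := measurableSet_Ioo.preimage measurable_norm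
  rw [← lintegral_indicator hA, ← Complex.lintegral_comp_polarCoord_symm, polarCoord_target,
    Measure.volume_eq_prod, ← Measure.prod_restrict, lintegral_prod]
  · calc _ ≤ ∫⁻ ρ in Ioi (0 : ℝ), (Ioo s t).indicator (fun _ => η) ρ := by
          refine setLIntegral_mono' measurableSet_Ioi fun ρ hρ => ?_
          have hρ0 : (0 : ℝ) < ρ := hρ
          simp only [smul_eq_mul]
          rw [lintegral_const_mul' _ _ ENNReal.ofReal_ne_top]
          have e : ∀ θ : ℝ, Complex.polarCoord.symm (ρ, θ) = circleMap 0 ρ θ := fun θ => by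
            rw [Complex.polarCoord_symm_apply, circleMap_zero, Complex.exp_mul_I]
            push_cast
            ring
          have e2 : ∀ θ : ℝ, ‖circleMap 0 ρ θ‖ = ρ := fun θ => by simp [abs_of_pos hρ0]
          by_cases hmem : ρ ∈ Ioo s t
          · rw [indicator_of_mem hmem]
            simp only [e]
            have : ∀ θ, {z : ℂ | ‖z‖ ∈ Ioo s t}.indicator σ (circleMap 0 ρ θ) =
                σ (circleMap 0 ρ θ) := fun θ => indicator_of_mem (by
                  rw [mem_ofPred_eq, e2]; exact hmem) _
            simp only [this]
            rw [setLIntegral_congr Ioo_ae_eq_Ioc]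
            have h2 := circleLIntegral_eq_setLIntegral σ 0 ρ (-π)
            rw [show -π + 2 * π = π by ring] at h2
            rw [← h2]
            calc _ ≤ 1 * η := by
                  refine mul_le_mul' ?_ (h ρ hmem)
                  rw [← ENNReal.ofReal_one]
                  exact ENNReal.ofReal_le_ofReal (hmem.2.le.trans ht)
              _ = η := one_mul _
          · have : ∀ θ, {z : ℂ | ‖z‖ ∈ Ioo s t}.indicator σ (circleMap 0 ρ θ) = 0 :=
              fun θ => indicator_of_notMem (by rw [mem_ofPred_eq, e2]; exact hmem) _
            simp only [e, this, lintegral_zero, mul_zero]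
            exact zero_le
    _ ≤ ∫⁻ ρ, (Ioo s t).indicator (fun _ => η) ρ := setLIntegral_le_lintegral _ _
    _ = ENNReal.ofReal (t - s) * η := by
          rw [lintegral_indicator measurableSet_Ioo, setLIntegral_const, Real.volume_Ioo, mul_comm]
  · refine Measurable.aemeasurable ?_
    have : Measurable fun p : ℝ × ℝ => Complex.polarCoord.symm p := by
      simp only [Complex.polarCoord_symm_apply]
      fun_prop
    exact (measurable_fst.ennreal_ofReal).mul ((hσ.indicator hA).comp this)

/-! ### Green's formula as an inequality for truncated weights -/

section Green

variable {ι κ : Type*} [Fintype ι] [Fintype κ] {u : ι → ℂ → ℂ} {v : κ → ℂ → ℂ}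

lemma circleLIntegral_sum_enorm_sq (hum : ∀ i, Measurable (u i))
    (hu : ∀ i, DifferentiableOn ℂ (u i) (ball 0 1)) {a : ℂ} {δ : ℝ} (hδ : 0 < δ)
    (h : closedBall a δ ⊆ ball 0 1) :
    circleLIntegral (fun z => ∑ i, ‖u i z‖ₑ ^ 2) a δ =
      ENNReal.ofReal (2 * π) * ∑ i, ‖u i a‖ₑ ^ 2 +
        ENNReal.ofReal δ ^ 2 * ∑ i, circleSlope (u i) δ a := by
  rw [circleLIntegral_sum fun i => (hum i).enorm.pow_const 2, Finset.mul_sum, Finset.mul_sum,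
    ← Finset.sum_add_distrib]
  exact Finset.sum_congr rfl fun i _ => circleLIntegral_enorm_sq hδ ((hu i).mono h)

/-- Green's inequality at scale `δ`: the circle mean is moved from `σ` to the truncated weight,
which is superharmonic up to an error in a thin annulus, where the means of `σ` are at most `η`. -/
lemma lintegral_circleSlope_mul_cutoffWeight_le (hum : ∀ i, Measurable (u i))
    (hu : ∀ i, DifferentiableOn ℂ (u i) (ball 0 1)) (hvm : ∀ j, Measurable (v j))
    (hv : ∀ j, DifferentiableOn ℂ (v j) (ball 0 1)) {σ : ℂ → ℝ≥0∞} (hσ : Measurable σ)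
    (huv : ∀ z ∈ ball (0 : ℂ) 1, ∑ j, ‖v j z‖ₑ ^ 2 = ∑ i, ‖u i z‖ₑ ^ 2 + σ z)
    {ω : ℂ → ℝ≥0∞} (hωm : Measurable ω)
    (hω : ∀ a δ, 0 < δ → closedBall a δ ⊆ ball (0 : ℂ) 1 →
      circleLIntegral ω a δ ≤ ENNReal.ofReal (2 * π) * ω a)
    {n r δ : ℝ} (hn : 0 ≤ n) (hδ : 0 < δ) (hδr : δ < r) (hrδ : r + 2 * δ < 1)
    {η : ℝ≥0∞} (hη : ∀ ρ ∈ Ioo (r - δ) (r + δ), circleLIntegral σ 0 ρ ≤ η) :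
    ∑ j, ∫⁻ a in ball (0 : ℂ) r, circleSlope (v j) δ a * cutoffWeight ω n r a ≤
      (∑ i, ∫⁻ a in ball (0 : ℂ) r, circleSlope (u i) δ a * cutoffWeight ω n r a) +
        ENNReal.ofReal (8 * π * n) * η := by
  have hr : 0 < r := hδ.trans hδr
  set W := cutoffWeight ω n r with hWdef
  have hWm : Measurable W := hωm.min (by fun_prop)
  set Qu : ℂ → ℝ≥0∞ := fun a => ∑ i, circleSlope (u i) δ a with hQu
  set Qv : ℂ → ℝ≥0∞ := fun a => ∑ j, circleSlope (v j) δ a with hQv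
  have hQum : Measurable Qu := Finset.measurable_fun_sum _ fun i _ =>
    measurable_circleSlope (hum i) δ
  have hσW : Measurable fun a => ENNReal.ofReal (2 * π) * (σ a * W a) := by fun_prop
  have hQW : Measurable fun a => ENNReal.ofReal δ ^ 2 * (Qu a * W a) := by fun_prop
  have hball : ∀ a ∈ ball (0 : ℂ) r, closedBall a δ ⊆ ball (0 : ℂ) 1 := fun a ha z hz => by
    rw [mem_closedBall, dist_eq_norm] at hz
    rw [mem_ball_zero_iff] at *
    linarith [norm_le_norm_add_norm_sub' z a]
  set B := volume.restrict (ball (0 : ℂ) r)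
  -- The discrete Laplacian of `σ` is the difference of the slope terms; it is written additively to
  -- avoid truncated subtraction.
  have hid : ∀ a ∈ ball (0 : ℂ) r, ENNReal.ofReal (2 * π) * σ a + ENNReal.ofReal δ ^ 2 * Qv a =
      ENNReal.ofReal δ ^ 2 * Qu a + circleLIntegral σ a δ := fun a ha => by
    have h1 := circleLIntegral_sum_enorm_sq hvm hv hδ (hball a ha)
    have h2 := circleLIntegral_sum_enorm_sq hum hu hδ (hball a ha)
    have ha1 : a ∈ ball (0 : ℂ) 1 := hball a ha (mem_closedBall_self hδ.le)
    rw [huv a ha1, circleLIntegral_congr (w := fun z => ∑ i, ‖u i z‖ₑ ^ 2 + σ z)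
      (fun θ => huv _ (hball a ha (circleMap_mem_closedBall a hδ.le θ))),
      circleLIntegral_add (Finset.measurable_fun_sum _ fun i _ => (hum i).enorm.pow_const 2), h2,
      mul_add, add_assoc, add_assoc] at h1
    have hfin : ENNReal.ofReal (2 * π) * ∑ i, ‖u i a‖ₑ ^ 2 ≠ ∞ :=
      ENNReal.mul_ne_top ENNReal.ofReal_ne_top
        (ENNReal.sum_ne_top.2 fun i _ => by finiteness)
    exact ((ENNReal.add_right_inj hfin).1 h1).symm
  have hWle : ∀ z, W z ≤ ENNReal.ofReal (n * r ^ 2) := fun z =>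
    (min_le_right _ _).trans (ENNReal.ofReal_le_ofReal
      (mul_le_mul_of_nonneg_left (by nlinarith [sq_nonneg ‖z‖]) hn))
  -- The weight vanishes off the ball, so integrals extend to the plane, where averaging over
  -- circles is symmetric.
  have hsW : ∀ X : ℂ → ℝ≥0∞, ∫⁻ a, X a * W a ∂B = ∫⁻ a, X a * W a := fun X => by
    refine setLIntegral_eq_of_support_subset fun a ha => ?_
    by_contra hmem
    rw [mem_ball_zero_iff, not_lt] at hmem
    exact ha (by simp only [hWdef, cutoffWeight_eq_zero ω hn hr.le hmem, mul_zero])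
  have hσfin : ∫⁻ a, σ a * W a ∂B ≠ ∞ := by
    have hcont : ContinuousOn (fun z => ∑ j, ‖v j z‖ ^ 2) (closedBall (0 : ℂ) r) :=
      continuousOn_finsetSum _ fun j _ => (((hv j).continuousOn.mono
        (closedBall_subset_ball (by linarith))).norm.pow 2)
    obtain ⟨C, hC⟩ := (isCompact_closedBall (0 : ℂ) r).exists_bound_of_continuousOn hcont
    have hb : ∀ a ∈ ball (0 : ℂ) r, σ a * W a ≤ ENNReal.ofReal C * ENNReal.ofReal (n * r ^ 2) := by
      intro a ha
      refine mul_le_mul' ?_ (hWle a)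
      have ha1 : a ∈ ball (0 : ℂ) 1 := hball a ha (mem_closedBall_self hδ.le)
      calc σ a ≤ ∑ j, ‖v j a‖ₑ ^ 2 := by rw [huv a ha1]; exact le_add_self
        _ = ENNReal.ofReal (∑ j, ‖v j a‖ ^ 2) := by
          rw [ENNReal.ofReal_sum_of_nonneg fun _ _ => by positivity]
          simp only [enorm_sq_eq_ofReal]
        _ ≤ ENNReal.ofReal C :=
          ENNReal.ofReal_le_ofReal ((le_abs_self _).trans (hC a (ball_subset_closedBall ha)))
    refine ((setLIntegral_mono' isOpen_ball.measurableSet hb).trans_lt ?_).ne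
    rw [setLIntegral_const]
    exact ENNReal.mul_lt_top (by finiteness) measure_ball_lt_top
  have hA : MeasurableSet {z : ℂ | ‖z‖ ∈ Ioo (r - δ) (r + δ)} :=
    measurableSet_Ioo.preimage measurable_norm
  have hM : ∫⁻ a, circleLIntegral σ a δ * W a ∂B ≤ ENNReal.ofReal (2 * π) * ∫⁻ a, σ a * W a ∂B +
      ENNReal.ofReal δ ^ 2 * (ENNReal.ofReal (8 * π * n) * η) := by
    rw [hsW, hsW]
    calc ∫⁻ a, circleLIntegral σ a δ * W a = ∫⁻ b, σ b * circleLIntegral W b δ := by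
          rw [← lintegral_mul_circleLIntegral_comm hσ hWm]
          simp only [mul_comm]
      _ ≤ ∫⁻ b, (ENNReal.ofReal (2 * π) * (σ b * W b) + ENNReal.ofReal (4 * π * n * δ) *
            {z : ℂ | ‖z‖ ∈ Ioo (r - δ) (r + δ)}.indicator σ b) := by
          refine lintegral_mono fun b => ?_
          refine (mul_le_mul' le_rfl
            (circleLIntegral_cutoffWeight_le hω hn hr hδ hrδ b)).trans (le_of_eq ?_)
          rw [mul_add, mul_left_comm]
          congr 1
          by_cases hb : b ∈ {z : ℂ | ‖z‖ ∈ Ioo (r - δ) (r + δ)}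
          · rw [indicator_of_mem hb, indicator_of_mem hb, mul_comm]
          · rw [indicator_of_notMem hb, indicator_of_notMem hb, mul_zero, mul_zero]
      _ = ENNReal.ofReal (2 * π) * (∫⁻ a, σ a * W a) + ENNReal.ofReal (4 * π * n * δ) *
            ∫⁻ z in {z : ℂ | ‖z‖ ∈ Ioo (r - δ) (r + δ)}, σ z := by
          rw [lintegral_add_left hσW,
            lintegral_const_mul' _ _ ENNReal.ofReal_ne_top,
            lintegral_const_mul' _ _ ENNReal.ofReal_ne_top, lintegral_indicator hA]
      _ ≤ _ := by
          refine add_le_add le_rfl ?_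
          -- Density `4πnδ` times width `2δ` gives `8πnδ²`: the error is quadratic in `δ` and
          -- survives division by `δ²` as a bounded term.
          refine (mul_le_mul' le_rfl (lintegral_annulus_le hσ (by linarith) hη)).trans (le_of_eq ?_)
          rw [← mul_assoc, ← mul_assoc, ← ENNReal.ofReal_mul (by positivity),
            ← ENNReal.ofReal_pow hδ.le, ← ENNReal.ofReal_mul (by positivity)]
          congr 2
          ring
  have hint : ENNReal.ofReal (2 * π) * ∫⁻ a, σ a * W a ∂B +
      ENNReal.ofReal δ ^ 2 * ∫⁻ a, Qv a * W a ∂B =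
      ENNReal.ofReal δ ^ 2 * ∫⁻ a, Qu a * W a ∂B + ∫⁻ a, circleLIntegral σ a δ * W a ∂B := by
    rw [← lintegral_const_mul' _ _ ENNReal.ofReal_ne_top, ← lintegral_const_mul' _ _ (by finiteness),
      ← lintegral_const_mul' _ _ (by finiteness), ← lintegral_add_left hσW,
      ← lintegral_add_left hQW]
    refine setLIntegral_congr_fun isOpen_ball.measurableSet fun a ha => ?_
    simp only [← mul_assoc, ← add_mul]
    rw [hid a ha]
  have hfinal : ENNReal.ofReal δ ^ 2 * ∫⁻ a, Qv a * W a ∂B ≤ ENNReal.ofReal δ ^ 2 *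
      (∫⁻ a, Qu a * W a ∂B + ENNReal.ofReal (8 * π * n) * η) := by
    -- Cancellation is legitimate because `hσfin` makes this term finite.
    refine (ENNReal.add_le_add_iff_left
      (a := ENNReal.ofReal (2 * π) * ∫⁻ a, σ a * W a ∂B) (by finiteness)).1 ?_
    rw [hint, mul_add]
    refine (add_le_add_right hM _).trans (le_of_eq ?_)
    ring
  have hδ2 : ENNReal.ofReal δ ^ 2 ≠ 0 := by simpa using hδ
  rw [ENNReal.mul_le_mul_iff_right hδ2 (by finiteness)] at hfinal
  have hVW : ∀ j, Measurable fun a => circleSlope (v j) δ a * W a := fun j =>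
    (measurable_circleSlope (hvm j) δ).mul hWm
  have hUW : ∀ i, Measurable fun a => circleSlope (u i) δ a * W a := fun i =>
    (measurable_circleSlope (hum i) δ).mul hWm
  rw [← lintegral_finsetSum _ fun j _ => hVW j, ← lintegral_finsetSum _ fun i _ => hUW i]
  simpa only [hQu, hQv, Finset.sum_mul] using hfinal

end Green

lemma lintegral_le_of_tendsto_of_le {α : Type*} [MeasurableSpace α] {μ : Measure α}
    {F : ℕ → α → ℝ≥0∞} {f : α → ℝ≥0∞} {c : ℕ → ℝ≥0∞} {c₀ : ℝ≥0∞} (hF : ∀ n, Measurable (F n))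
    (hlim : ∀ᵐ x ∂μ, Tendsto (fun n => F n x) atTop (𝓝 (f x)))
    (hle : ∀ᶠ n in atTop, ∫⁻ x, F n x ∂μ ≤ c n) (hc : Tendsto c atTop (𝓝 c₀)) :
    ∫⁻ x, f x ∂μ ≤ c₀ :=
  calc ∫⁻ x, f x ∂μ = ∫⁻ x, liminf (fun n => F n x) atTop ∂μ :=
        lintegral_congr_ae (hlim.mono fun _ hx => hx.liminf_eq.symm)
    _ ≤ liminf (fun n => ∫⁻ x, F n x ∂μ) atTop := lintegral_liminf_le hF
    _ ≤ liminf c atTop := liminf_le_liminf hle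
    _ = c₀ := hc.liminf_eq

section Green

variable {ι κ : Type*} [Fintype ι] [Fintype κ] {u : ι → ℂ → ℂ} {v : κ → ℂ → ℂ}

/-- Let `δ → 0` and divide by `2π`; the error `8πnη` becomes `4nη`. -/
lemma lintegral_deriv_sq_mul_cutoffWeight_le (hum : ∀ i, Measurable (u i))
    (hu : ∀ i, DifferentiableOn ℂ (u i) (ball 0 1)) (hvm : ∀ j, Measurable (v j))
    (hv : ∀ j, DifferentiableOn ℂ (v j) (ball 0 1)) {σ : ℂ → ℝ≥0∞} (hσ : Measurable σ)
    (huv : ∀ z ∈ ball (0 : ℂ) 1, ∑ j, ‖v j z‖ₑ ^ 2 = ∑ i, ‖u i z‖ₑ ^ 2 + σ z)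
    {ω : ℂ → ℝ≥0∞} (hωm : Measurable ω)
    (hω : ∀ a δ, 0 < δ → closedBall a δ ⊆ ball (0 : ℂ) 1 →
      circleLIntegral ω a δ ≤ ENNReal.ofReal (2 * π) * ω a)
    {n ρ₀ r : ℝ} (hn : 0 ≤ n) (hρ₀ : 0 ≤ ρ₀) (hρr : ρ₀ < r) (hr : r < 1)
    {η : ℝ≥0∞} (hη : ∀ ρ ∈ Ioo ρ₀ 1, circleLIntegral σ 0 ρ ≤ η) :
    ∑ j, ∫⁻ a in ball (0 : ℂ) r, ‖deriv (v j) a‖ₑ ^ 2 * cutoffWeight ω n r a ≤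
      (∑ i, ∫⁻ a in ball (0 : ℂ) r, ‖deriv (u i) a‖ₑ ^ 2 * cutoffWeight ω n r a) +
        ENNReal.ofReal (4 * n) * η := by
  have hWm : Measurable (cutoffWeight ω n r) := hωm.min (by fun_prop)
  have hWfin : ∫⁻ z in ball (0 : ℂ) r, cutoffWeight ω n r z ≠ ∞ := by
    have hle : ∀ z, cutoffWeight ω n r z ≤ ENNReal.ofReal (n * r ^ 2) := fun z =>
      (min_le_right _ _).trans (ENNReal.ofReal_le_ofReal
        (mul_le_mul_of_nonneg_left (by nlinarith [sq_nonneg ‖z‖]) hn))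
    refine ((lintegral_mono hle).trans_lt ?_).ne
    rw [setLIntegral_const]
    exact ENNReal.mul_lt_top (by finiteness) measure_ball_lt_top
  have h1 : Tendsto (fun δ => ∑ j, ∫⁻ a in ball (0 : ℂ) r, circleSlope (v j) δ a *
      cutoffWeight ω n r a) (𝓝[>] 0) (𝓝 (∑ j, ENNReal.ofReal (2 * π) *
        ∫⁻ a in ball (0 : ℂ) r, ‖deriv (v j) a‖ₑ ^ 2 * cutoffWeight ω n r a)) :=
    tendsto_finsetSum _ fun j _ => tendsto_lintegral_circleSlope_mul (hvm j) (hv j) hWm hr hWfin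
  have h2 : Tendsto (fun δ => ∑ i, ∫⁻ a in ball (0 : ℂ) r, circleSlope (u i) δ a *
      cutoffWeight ω n r a) (𝓝[>] 0) (𝓝 (∑ i, ENNReal.ofReal (2 * π) *
        ∫⁻ a in ball (0 : ℂ) r, ‖deriv (u i) a‖ₑ ^ 2 * cutoffWeight ω n r a)) :=
    tendsto_finsetSum _ fun i _ => tendsto_lintegral_circleSlope_mul (hum i) (hu i) hWm hr hWfin
  have h3 := le_of_tendsto_of_tendsto h1
    (h2.add_const (ENNReal.ofReal (8 * π * n) * η)) (by
      filter_upwards [Ioo_mem_nhdsGT (show 0 < min (r - ρ₀) ((1 - r) / 2) from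
        lt_min (by linarith) (by linarith))] with δ hδ
      have hδ1 := hδ.2.trans_le (min_le_left _ _)
      have hδ2 := hδ.2.trans_le (min_le_right _ _)
      exact lintegral_circleSlope_mul_cutoffWeight_le hum hu hvm hv hσ huv hωm hω hn hδ.1
        (by linarith) (by linarith) fun ρ hρ => hη ρ ⟨by linarith [hρ.1], by linarith [hρ.2]⟩)
  have e : ENNReal.ofReal (8 * π * n) * η =
      ENNReal.ofReal (2 * π) * (ENNReal.ofReal (4 * n) * η) := by
    rw [← mul_assoc, ← ENNReal.ofReal_mul (by positivity)]
    congr 2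
    ring
  rw [← Finset.mul_sum, ← Finset.mul_sum, e, ← mul_add] at h3
  exact (ENNReal.mul_le_mul_iff_right (by simp [pi_pos]) ENNReal.ofReal_ne_top).1 h3

lemma cutoffWeight_le (ω : ℂ → ℝ≥0∞) (n r : ℝ) (z : ℂ) : cutoffWeight ω n r z ≤ ω z :=
  min_le_left _ _

/-- The order of limits matters: with `n` fixed, `r → 1` makes the error `4nη` disappear; only then
does `n → ∞` restore `ω` by Fatou's lemma. -/
lemma lintegral_deriv_sq_mul_le (hum : ∀ i, Measurable (u i))
    (hu : ∀ i, DifferentiableOn ℂ (u i) (ball 0 1)) (hvm : ∀ j, Measurable (v j))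
    (hv : ∀ j, DifferentiableOn ℂ (v j) (ball 0 1)) {σ : ℂ → ℝ≥0∞} (hσ : Measurable σ)
    (huv : ∀ z ∈ ball (0 : ℂ) 1, ∑ j, ‖v j z‖ₑ ^ 2 = ∑ i, ‖u i z‖ₑ ^ 2 + σ z)
    {ω : ℂ → ℝ≥0∞} (hωm : Measurable ω)
    (hω : ∀ a δ, 0 < δ → closedBall a δ ⊆ ball (0 : ℂ) 1 →
      circleLIntegral ω a δ ≤ ENNReal.ofReal (2 * π) * ω a)
    (hη : Tendsto (fun ρ => circleLIntegral σ 0 ρ) (𝓝[<] 1) (𝓝 0)) :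
    ∑ j, ∫⁻ a in ball (0 : ℂ) 1, ‖deriv (v j) a‖ₑ ^ 2 * ω a ≤
      ∑ i, ∫⁻ a in ball (0 : ℂ) 1, ‖deriv (u i) a‖ₑ ^ 2 * ω a := by
  set X := ∑ i, ∫⁻ a in ball (0 : ℂ) 1, ‖deriv (u i) a‖ₑ ^ 2 * ω a
  set V : ℂ → ℝ≥0∞ := fun a => ∑ j, ‖deriv (v j) a‖ₑ ^ 2 with hV
  have hVm : Measurable V := Finset.measurable_fun_sum _ fun j _ =>
    (measurable_deriv (v j)).enorm.pow_const 2
  have hVfin : ∀ a, V a ≠ ∞ := fun a => ENNReal.sum_ne_top.2 fun j _ => by finiteness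
  have hWm : ∀ n r, Measurable (cutoffWeight ω n r) := fun n r => hωm.min (by fun_prop)
  have hVW : ∀ (W : ℂ → ℝ≥0∞), Measurable W → ∀ s : Set ℂ,
      ∑ j, ∫⁻ a in s, ‖deriv (v j) a‖ₑ ^ 2 * W a = ∫⁻ a in s, V a * W a := fun W hW s => by
    have : ∀ j, Measurable fun a => ‖deriv (v j) a‖ₑ ^ 2 * W a := fun j =>
      ((measurable_deriv (v j)).enorm.pow_const 2).mul hW
    rw [← lintegral_finsetSum _ fun j _ => this j]
    simp only [hV, Finset.sum_mul]
  have hstep : ∀ n r : ℝ, 0 ≤ n → ∀ e, (∃ ρ₀, 0 ≤ ρ₀ ∧ ρ₀ < r ∧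
      ∀ ρ ∈ Ioo ρ₀ 1, circleLIntegral σ 0 ρ ≤ e) → r < 1 →
      ∫⁻ a in ball (0 : ℂ) 1, V a * cutoffWeight ω n r a ≤ X + ENNReal.ofReal (4 * n) * e := by
    rintro n r hn e ⟨ρ₀, hρ₀, hρr, hle⟩ hr
    have hsub : ball (0 : ℂ) r ⊆ ball 0 1 := ball_subset_ball hr.le
    have h1 : ∫⁻ a in ball (0 : ℂ) 1, V a * cutoffWeight ω n r a =
        ∫⁻ a in ball (0 : ℂ) r, V a * cutoffWeight ω n r a := by
      have hsupp : (Function.support fun a => V a * cutoffWeight ω n r a) ⊆ ball (0 : ℂ) r :=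
        fun a ha => by
          by_contra hmem
          rw [mem_ball_zero_iff, not_lt] at hmem
          exact ha (by simp only [cutoffWeight_eq_zero ω hn (hρ₀.trans hρr.le) hmem, mul_zero])
      rw [setLIntegral_eq_of_support_subset hsupp,
        setLIntegral_eq_of_support_subset (hsupp.trans hsub)]
    rw [h1, ← hVW _ (hWm n r)]
    refine (lintegral_deriv_sq_mul_cutoffWeight_le hum hu hvm hv hσ huv hωm hω hn hρ₀ hρr hr
      hle).trans ?_
    refine add_le_add (Finset.sum_le_sum fun i _ => ?_) le_rfl
    refine (lintegral_mono_set hsub).trans (lintegral_mono fun a => ?_)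
    exact mul_le_mul' le_rfl (cutoffWeight_le ω n r a)
  have hlim1 : ∀ n : ℝ, 0 ≤ n → ∫⁻ a in ball (0 : ℂ) 1, V a * cutoffWeight ω n 1 a ≤ X := by
    intro n hn
    refine le_of_forall_pos_le_add fun e he => ?_
    -- Dividing by `4n + 1` rather than `4n` also covers `n = 0`.
    obtain ⟨e', he', hee⟩ : ∃ e' > 0, ENNReal.ofReal (4 * n) * e' ≤ e := by
      refine ⟨e / (ENNReal.ofReal (4 * n) + 1),
        ENNReal.div_pos he.ne' (by finiteness), ?_⟩
      rw [← mul_div_assoc]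
      refine ENNReal.div_le_of_le_mul ?_
      rw [mul_comm]
      gcongr
      exact le_self_add
    have hev := ENNReal.tendsto_nhds_zero.1 hη e' he'
    obtain ⟨ρ₁, hρ₁, hρ₁'⟩ := (mem_nhdsLT_iff_exists_Ioo_subset' (zero_lt_one)).1 hev
    obtain ⟨r, -, hr1, hr⟩ := exists_seq_strictMono_tendsto'
      (show max ρ₁ 0 < 1 from max_lt hρ₁ one_pos)
    refine lintegral_le_of_tendsto_of_le (F := fun k a => V a * cutoffWeight ω n (r k) a)
      (c := fun _ => X + e) (fun k => hVm.mul (hWm n (r k))) ?_ ?_ tendsto_const_nhds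
    · refine Eventually.of_forall fun a => ENNReal.Tendsto.const_mul ?_ (Or.inr (hVfin a))
      refine tendsto_const_nhds.min (ENNReal.tendsto_ofReal ?_)
      exact ((hr.pow 2).sub_const _).const_mul n
    · refine Eventually.of_forall fun k => ?_
      refine (hstep n (r k) hn e' ⟨max ρ₁ 0, le_max_right _ _, (hr1 k).1, fun ρ hρ =>
        hρ₁' ⟨(le_max_left _ _).trans_lt hρ.1, hρ.2⟩⟩ (hr1 k).2).trans ?_
      gcongr
  rw [hVW ω hωm]
  refine lintegral_le_of_tendsto_of_le (F := fun (n : ℕ) a => V a * cutoffWeight ω n 1 a)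
    (c := fun _ => X) (fun n => hVm.mul (hWm n 1)) ?_
    (Eventually.of_forall fun n => hlim1 n n.cast_nonneg) tendsto_const_nhds
  filter_upwards [ae_restrict_mem isOpen_ball.measurableSet] with a ha
  refine ENNReal.Tendsto.const_mul ?_ (Or.inr (hVfin a))
  have ha' : ‖a‖ < 1 := by simpa using ha
  have h1 : Tendsto (fun n : ℕ => (n : ℝ) * (1 ^ 2 - ‖a‖ ^ 2)) atTop atTop :=
    tendsto_natCast_atTop_atTop.atTop_mul_const (by nlinarith [norm_nonneg a])
  have h2 : Tendsto (fun n : ℕ => ENNReal.ofReal ((n : ℝ) * (1 ^ 2 - ‖a‖ ^ 2))) atTop (𝓝 ∞) :=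
    ENNReal.tendsto_ofReal_atTop.comp h1
  have h3 := (tendsto_const_nhds (x := ω a)).min h2
  rwa [min_eq_left le_top] at h3

end Green

/-! ### The comparison principle for superharmonic weights and outer functions -/

/-- As `U` is open and `ω` is nonnegative, extension by zero remains lower semicontinuous on the
whole plane. -/
lemma IsPosSuperharmonicOn.measurable_indicator {ω : ℂ → ℝ≥0∞} {U : Set ℂ} (hU : IsOpen U)
    (hω : IsPosSuperharmonicOn ω U) : Measurable (U.indicator ω) := by
  refine LowerSemicontinuous.measurable (lowerSemicontinuous_iff_isOpen_preimage.2 fun y => ?_)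
  obtain ⟨t, ht, hte⟩ := lowerSemicontinuousOn_iff_preimage_Ioi.1 hω.lowerSemicontinuousOn y
  have : U.indicator ω ⁻¹' Ioi y = U ∩ ω ⁻¹' Ioi y := by
    ext z
    by_cases hz : z ∈ U <;> simp [hz]
  rw [this, hte]
  exact hU.inter ht

lemma IsPosSuperharmonicOn.circleLIntegral_le {ω : ℂ → ℝ≥0∞} {U : Set ℂ}
    (hω : IsPosSuperharmonicOn ω U) {a : ℂ} {δ : ℝ} (hδ : 0 < δ) (h : closedBall a δ ⊆ U) :
    circleLIntegral (U.indicator ω) a δ ≤ ENNReal.ofReal (2 * π) * U.indicator ω a := by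
  rw [indicator_of_mem (h (mem_closedBall_self hδ.le))]
  refine (circleLIntegral_mono (w := ω) fun θ => indicator_le_self _ _ _).trans ?_
  have := hω.circle_mean_le a δ hδ h
  rwa [ENNReal.div_le_iff (by simp [pi_pos]) ENNReal.ofReal_ne_top, mul_comm (ω a)] at this

/-- Comparison of weighted Dirichlet integrals: if `∑ |uᵢ|² ≤ ∑ |vⱼ|²` in the disc, with equality
on the circle in the sense of means, then `∑ D(vⱼ) ≤ ∑ D(uᵢ)`. -/
theorem sum_dirichletIntegral_le {ι κ : Type*} [Fintype ι] [Fintype κ] {u : ι → ℂ → ℂ}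
    {v : κ → ℂ → ℂ} {ω : ℂ → ℝ≥0∞} (hω : IsSuperharmonicWeight ω)
    (hu : ∀ i, DifferentiableOn ℂ (u i) (ball 0 1)) (hv : ∀ j, DifferentiableOn ℂ (v j) (ball 0 1))
    (huv : ∀ z ∈ ball (0 : ℂ) 1, ∑ i, ‖u i z‖ ^ 2 ≤ ∑ j, ‖v j z‖ ^ 2)
    (hmean : Tendsto (fun ρ => circleAverage (fun z => ∑ j, ‖v j z‖ ^ 2 - ∑ i, ‖u i z‖ ^ 2) 0 ρ)
      (𝓝[<] 1) (𝓝 0)) :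
    ∑ j, dirichletIntegral ω (v j) ≤ ∑ i, dirichletIntegral ω (u i) := by
  -- Nothing is known outside the disc; extension by zero gives global measurability and leaves
  -- values and derivatives inside unchanged.
  have hmeas : ∀ f : ℂ → ℂ, DifferentiableOn ℂ f (ball 0 1) →
      Measurable ((ball (0 : ℂ) 1).indicator f) := fun f hf => by
    classical
    rw [← piecewise_eq_indicator]
    exact hf.continuousOn.measurable_piecewise continuousOn_const isOpen_ball.measurableSet
  have heq : ∀ f : ℂ → ℂ, EqOn ((ball (0 : ℂ) 1).indicator f) f (ball 0 1) := fun f =>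
    eqOn_indicator
  have hderiv : ∀ f : ℂ → ℂ, dirichletIntegral ω f = (∫⁻ a in ball (0 : ℂ) 1,
      ‖deriv ((ball (0 : ℂ) 1).indicator f) a‖ₑ ^ 2 * (ball (0 : ℂ) 1).indicator ω a) /
        ENNReal.ofReal π := fun f => by
    rw [dirichletIntegral]
    congr 1
    refine setLIntegral_congr_fun isOpen_ball.measurableSet fun a ha => ?_
    have := ((heq f).eventuallyEq_of_mem (isOpen_ball.mem_nhds ha)).deriv_eq
    simp only [this, indicator_of_mem ha]
  simp only [hderiv, div_eq_mul_inv]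
  rw [← Finset.sum_mul, ← Finset.sum_mul]
  refine mul_le_mul' ?_ le_rfl
  set u' : ι → ℂ → ℂ := fun i => (ball (0 : ℂ) 1).indicator (u i) with hu'
  set v' : κ → ℂ → ℂ := fun j => (ball (0 : ℂ) 1).indicator (v j) with hv'
  have hum : ∀ i, Measurable (u' i) := fun i => hmeas _ (hu i)
  have hvm : ∀ j, Measurable (v' j) := fun j => hmeas _ (hv j)
  set σ : ℂ → ℝ≥0∞ := fun z => ∑ j, ‖v' j z‖ₑ ^ 2 - ∑ i, ‖u' i z‖ₑ ^ 2 with hσdef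
  have hσ : Measurable σ := (Finset.measurable_fun_sum _ fun j _ => (hvm j).enorm.pow_const 2).sub
    (Finset.measurable_fun_sum _ fun i _ => (hum i).enorm.pow_const 2)
  have hSu : ∀ z ∈ ball (0 : ℂ) 1, ∑ i, ‖u' i z‖ₑ ^ 2 = ENNReal.ofReal (∑ i, ‖u i z‖ ^ 2) :=
    fun z hz => by
      rw [ENNReal.ofReal_sum_of_nonneg fun _ _ => by positivity]
      simp only [← enorm_sq_eq_ofReal, hu', heq _ hz]
  have hSv : ∀ z ∈ ball (0 : ℂ) 1, ∑ j, ‖v' j z‖ₑ ^ 2 = ENNReal.ofReal (∑ j, ‖v j z‖ ^ 2) :=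
    fun z hz => by
      rw [ENNReal.ofReal_sum_of_nonneg fun _ _ => by positivity]
      simp only [← enorm_sq_eq_ofReal, hv', heq _ hz]
  refine lintegral_deriv_sq_mul_le hum (fun i => (hu i).congr (heq _)) hvm
    (fun j => (hv j).congr (heq _)) hσ (fun z hz => ?_)
    (hω.superharmonic.measurable_indicator isOpen_ball)
    (fun a δ hδ h => hω.superharmonic.circleLIntegral_le hδ h) ?_
  · rw [hσdef, add_tsub_cancel_of_le]
    rw [hSu z hz, hSv z hz]
    exact ENNReal.ofReal_le_ofReal (huv z hz)
  · have h1 := ENNReal.Tendsto.const_mul (a := ENNReal.ofReal (2 * π))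
      (ENNReal.tendsto_ofReal hmean) (Or.inr ENNReal.ofReal_ne_top)
    rw [ENNReal.ofReal_zero, mul_zero] at h1
    refine h1.congr' ?_
    filter_upwards [Ioo_mem_nhdsLT (show (0 : ℝ) < 1 by norm_num)] with ρ hρ
    have hmem : ∀ θ, circleMap 0 ρ θ ∈ ball (0 : ℂ) 1 := fun θ => by
      rw [circleMap_zero_eq_mul]
      exact mul_circleMap_mem_ball hρ θ
    have hsphere : sphere (0 : ℂ) ρ ⊆ ball 0 1 := fun z hz => by
      rw [mem_sphere_zero_iff_norm] at hz
      rw [mem_ball_zero_iff, hz]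
      exact hρ.2
    have hci : CircleIntegrable (fun z => ∑ j, ‖v j z‖ ^ 2 - ∑ i, ‖u i z‖ ^ 2) 0 ρ :=
      ContinuousOn.circleIntegrable hρ.1.le
        ((continuousOn_finsetSum _ fun j _ => ((hv j).continuousOn.mono hsphere).norm.pow 2).sub
          (continuousOn_finsetSum _ fun i _ => ((hu i).continuousOn.mono hsphere).norm.pow 2))
    rw [ofReal_circleAverage_eq_lintegral hci fun θ => sub_nonneg.2 (huv _ (hmem θ)), ← mul_assoc,
      ← ENNReal.ofReal_mul (by positivity), mul_inv_cancel₀ (by positivity), ENNReal.ofReal_one,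
      one_mul, circleLIntegral]
    refine lintegral_congr fun θ => ?_
    rw [hσdef]
    simp only
    rw [hSu _ (hmem θ), hSv _ (hmem θ), ENNReal.ofReal_sub _ (by positivity)]

lemma CircleIntegrable.sup {a b : ℂ → ℝ} (ha : CircleIntegrable a 0 1)
    (hb : CircleIntegrable b 0 1) : CircleIntegrable (fun ζ => max (a ζ) (b ζ)) 0 1 := by
  simp only [CircleIntegrable, intervalIntegrable_iff] at *
  exact Integrable.sup ha hb

lemma CircleIntegrable.inf {a b : ℂ → ℝ} (ha : CircleIntegrable a 0 1)
    (hb : CircleIntegrable b 0 1) : CircleIntegrable (fun ζ => min (a ζ) (b ζ)) 0 1 := by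
  simp only [CircleIntegrable, intervalIntegrable_iff] at *
  exact Integrable.inf ha hb

lemma CircleIntegrable.exp_two_mul_of_le {c φ : ℂ → ℝ} (hc : CircleIntegrable c 0 1)
    (hφ : CircleIntegrable φ 0 1) (h : ∀ ζ, exp (2 * c ζ) ≤ φ ζ) :
    CircleIntegrable (fun ζ => exp (2 * c ζ)) 0 1 := by
  simp only [CircleIntegrable, intervalIntegrable_iff] at *
  refine Integrable.mono' hφ (continuous_exp.comp_aestronglyMeasurable (hc.1.const_mul 2)) ?_
  refine Eventually.of_forall fun θ => ?_
  rw [Real.norm_of_nonneg (exp_pos _).le]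
  exact h _

/-- Comparison of the weighted Dirichlet integrals of outer functions whose boundary moduli satisfy
`∑ |uᵢ|² = ∑ |vⱼ|²`. -/
theorem sum_dirichletIntegral_outerExp_le {ι κ : Type*} [Fintype ι] [Fintype κ] {a : ι → ℂ → ℝ}
    {b : κ → ℂ → ℝ} {ω : ℂ → ℝ≥0∞} (hω : IsSuperharmonicWeight ω)
    (ha : ∀ i, CircleIntegrable (a i) 0 1) (hb : ∀ j, CircleIntegrable (b j) 0 1)
    (ha2 : ∀ i, CircleIntegrable (fun ζ => exp (2 * a i ζ)) 0 1)
    (hb2 : ∀ j, CircleIntegrable (fun ζ => exp (2 * b j ζ)) 0 1)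
    (hbd : ∀ ζ, ∑ i, exp (2 * a i ζ) = ∑ j, exp (2 * b j ζ))
    (hle : ∀ z ∈ ball (0 : ℂ) 1, ∑ i, ‖outerExp (a i) z‖ ^ 2 ≤ ∑ j, ‖outerExp (b j) z‖ ^ 2) :
    ∑ j, dirichletIntegral ω (outerExp (b j)) ≤ ∑ i, dirichletIntegral ω (outerExp (a i)) := by
  refine sum_dirichletIntegral_le hω (fun i => differentiableOn_outerExp (ha i))
    (fun j => differentiableOn_outerExp (hb j)) hle ?_
  have h1 := (tendsto_finsetSum Finset.univ fun j _ =>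
    tendsto_circleAverage_norm_sq_outerExp (hb j) (hb2 j)).sub
    (tendsto_finsetSum Finset.univ fun i _ =>
      tendsto_circleAverage_norm_sq_outerExp (ha i) (ha2 i))
  rw [← circleAverage_fun_sum fun i _ => ha2 i, ← circleAverage_fun_sum fun j _ => hb2 j] at h1
  simp only [hbd, sub_self] at h1
  refine h1.congr' ?_
  filter_upwards [Ioo_mem_nhdsLT (show (0 : ℝ) < 1 by norm_num)] with ρ hρ
  have hci : ∀ c : ℂ → ℝ, CircleIntegrable c 0 1 →
      CircleIntegrable (fun z => ‖outerExp c z‖ ^ 2) 0 ρ := fun c hc => by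
    refine ContinuousOn.circleIntegrable hρ.1.le ?_
    refine ((differentiableOn_outerExp hc).continuousOn.mono fun z hz => ?_).norm.pow 2
    rw [mem_sphere_zero_iff_norm] at hz
    rw [mem_ball_zero_iff, hz]
    exact hρ.2
  rw [circleAverage_fun_sub (CircleIntegrable.fun_sum _ fun j _ => hci _ (hb j))
      (CircleIntegrable.fun_sum _ fun i _ => hci _ (ha i)),
    circleAverage_fun_sum fun i _ => hci _ (ha i), circleAverage_fun_sum fun j _ => hci _ (hb j)]

/-! ### Constants and scaling -/

lemma dirichletIntegral_const_mul {ω : ℂ → ℝ≥0∞} {f g : ℂ → ℂ} (α : ℂ)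
    (h : ∀ z ∈ ball (0 : ℂ) 1, f z = α * g z) :
    dirichletIntegral ω f = ‖α‖ₑ ^ 2 * dirichletIntegral ω g := by
  rw [dirichletIntegral, dirichletIntegral, ← mul_div_assoc,
    ← lintegral_const_mul' _ _ (by finiteness)]
  congr 1
  refine setLIntegral_congr_fun isOpen_ball.measurableSet fun z hz => ?_
  have h1 : f =ᶠ[𝓝 z] fun z => α * g z := by
    filter_upwards [isOpen_ball.mem_nhds hz] with w hw using h w hw
  simp only [h1.deriv_eq, deriv_const_mul_field, enorm_mul, mul_pow, mul_assoc]

lemma outerExp_const (c : ℝ) {z : ℂ} (hz : z ∈ ball (0 : ℂ) 1) :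
    outerExp (fun _ => c) z = exp c := by
  have hcl : DiffContOnCl ℂ (fun _ : ℂ => (2 * c : ℂ)) (ball 0 |1|) := diffContOnCl_const
  have h1 := hcl.circleAverage_smul_div (w := z) (by simpa using hz)
  have hne : ∀ ζ ∈ sphere (0 : ℂ) 1, ζ - z ≠ 0 := fun ζ hζ h => by
    rw [sub_eq_zero] at h
    rw [mem_sphere_zero_iff_norm, h] at hζ
    rw [mem_ball_zero_iff, hζ] at hz
    exact lt_irrefl _ hz
  have h2 : circleAverage (fun ζ => (ζ + z) / (ζ - z) * (c : ℂ)) 0 1 = c := by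
    have e : circleAverage (fun ζ => (ζ + z) / (ζ - z) * (c : ℂ)) 0 1 =
        circleAverage (fun ζ => (ζ / (ζ - z)) * (2 * c : ℂ) - (c : ℂ)) 0 1 := by
      refine circleAverage_congr_sphere fun ζ hζ => ?_
      have := hne ζ (by simpa using hζ)
      field_simp
      ring
    have hci : CircleIntegrable (fun ζ : ℂ => (ζ / (ζ - z)) * (2 * c : ℂ)) 0 1 :=
      ContinuousOn.circleIntegrable zero_le_one
        ((continuousOn_id.div (by fun_prop) hne).mul continuousOn_const)
    rw [e, circleAverage_fun_sub hci (circleIntegrable_const _ _ _), circleAverage_const]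
    simp only [sub_zero, smul_eq_mul] at h1
    rw [h1]
    ring
  rw [outerExp, h2, Complex.ofReal_exp]

lemma outerExp_add_const {h : ℂ → ℝ} (hh : CircleIntegrable h 0 1) (c : ℝ) {z : ℂ}
    (hz : z ∈ ball (0 : ℂ) 1) :
    outerExp (fun ζ => h ζ + c) z = (exp c : ℂ) * outerExp h z := by
  rw [outerExp_add hh (circleIntegrable_const _ _ _) hz, outerExp_const c hz, mul_comm]

lemma dirichletIntegral_outerExp_add_const {ω : ℂ → ℝ≥0∞} {h : ℂ → ℝ}
    (hh : CircleIntegrable h 0 1) (c : ℝ) :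
    dirichletIntegral ω (outerExp fun ζ => h ζ + c) =
      ENNReal.ofReal (exp c ^ 2) * dirichletIntegral ω (outerExp h) := by
  rw [dirichletIntegral_const_mul _ fun z hz => outerExp_add_const hh c hz, enorm_sq_eq_ofReal]
  simp [Complex.norm_exp]

lemma dirichletIntegral_outerExp_const {ω : ℂ → ℝ≥0∞} (c : ℝ) :
    dirichletIntegral ω (outerExp fun _ => c) = 0 := by
  rw [dirichletIntegral_const_mul (f := outerExp fun _ => c) (g := fun _ => (1 : ℂ)) (exp c : ℂ)
    fun z hz => by rw [outerExp_const c hz, mul_one]]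
  simp [dirichletIntegral]

/-! ### The lattice inequality and the bound for `f ∧ f²` -/

section Lattice

variable {ω : ℂ → ℝ≥0∞} {a b : ℂ → ℝ}

/-- With moduli `x, y` and `X, Y`, one has `X ≥ x, y` and `XY = xy`, since max plus min equals the
sum. Hence `X²(X² + Y² - x² - y²) = (X² - x²)(X² - y²) ≥ 0`. -/
lemma norm_sq_add_norm_sq_outerExp_le (ha : CircleIntegrable a 0 1) (hb : CircleIntegrable b 0 1)
    {z : ℂ} (hz : z ∈ ball (0 : ℂ) 1) :
    ‖outerExp a z‖ ^ 2 + ‖outerExp b z‖ ^ 2 ≤ ‖outerExp (fun ζ => max (a ζ) (b ζ)) z‖ ^ 2 +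
      ‖outerExp (fun ζ => min (a ζ) (b ζ)) z‖ ^ 2 := by
  have h1 := norm_outerExp_mono ha (ha.sup hb) (fun ζ => le_max_left _ _) hz
  have h2 := norm_outerExp_mono hb (ha.sup hb) (fun ζ => le_max_right _ _) hz
  have h3 : ‖outerExp (fun ζ => max (a ζ) (b ζ)) z‖ * ‖outerExp (fun ζ => min (a ζ) (b ζ)) z‖ =
      ‖outerExp a z‖ * ‖outerExp b z‖ := by
    rw [← norm_mul, ← norm_mul, ← outerExp_add (ha.sup hb) (ha.inf hb) hz, ← outerExp_add ha hb hz]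
    simp only [max_add_min]
  have h4 : 0 < ‖outerExp (fun ζ => max (a ζ) (b ζ)) z‖ := by
    rw [norm_outerExp (ha.sup hb) hz]
    exact exp_pos _
  set x := ‖outerExp a z‖
  set y := ‖outerExp b z‖
  set X := ‖outerExp (fun ζ => max (a ζ) (b ζ)) z‖
  set Y := ‖outerExp (fun ζ => min (a ζ) (b ζ)) z‖
  have hx : 0 ≤ x := norm_nonneg _
  have hy : 0 ≤ y := norm_nonneg _
  have h5 : 0 ≤ (X ^ 2 - x ^ 2) * (X ^ 2 - y ^ 2) := by
    refine mul_nonneg ?_ ?_ <;> nlinarith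
  have h6 : (X ^ 2 - x ^ 2) * (X ^ 2 - y ^ 2) = X ^ 2 * (X ^ 2 + Y ^ 2 - (x ^ 2 + y ^ 2)) := by
    linear_combination (-(X * Y) - x * y) * h3
  rw [h6] at h5
  have := nonneg_of_mul_nonneg_right h5 (by positivity)
  linarith

/-- The lattice inequality for outer functions, in terms of the logarithms of their boundary
moduli. -/
lemma dirichletIntegral_max_add_min_le (hω : IsSuperharmonicWeight ω)
    (ha : CircleIntegrable a 0 1) (hb : CircleIntegrable b 0 1)
    (ha2 : CircleIntegrable (fun ζ => exp (2 * a ζ)) 0 1)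
    (hb2 : CircleIntegrable (fun ζ => exp (2 * b ζ)) 0 1) :
    dirichletIntegral ω (outerExp fun ζ => max (a ζ) (b ζ)) +
      dirichletIntegral ω (outerExp fun ζ => min (a ζ) (b ζ)) ≤
        dirichletIntegral ω (outerExp a) + dirichletIntegral ω (outerExp b) := by
  have hab := ha2.add hb2
  have hmax : ∀ ζ, exp (2 * max (a ζ) (b ζ)) ≤ exp (2 * a ζ) + exp (2 * b ζ) := fun ζ => by
    rcases max_choice (a ζ) (b ζ) with h | h <;> rw [h] <;>
    linarith [exp_pos (2 * a ζ), exp_pos (2 * b ζ)]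
  have hmin : ∀ ζ, exp (2 * min (a ζ) (b ζ)) ≤ exp (2 * a ζ) + exp (2 * b ζ) := fun ζ => by
    rcases min_choice (a ζ) (b ζ) with h | h <;> rw [h] <;>
    linarith [exp_pos (2 * a ζ), exp_pos (2 * b ζ)]
  have := sum_dirichletIntegral_outerExp_le (a := ![a, b])
    (b := ![fun ζ => max (a ζ) (b ζ), fun ζ => min (a ζ) (b ζ)]) hω
    (by simp [Fin.forall_fin_two, ha, hb])
    (by simp [Fin.forall_fin_two, ha.sup hb, ha.inf hb])
    (by simp [Fin.forall_fin_two, ha2, hb2])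
    (by
      simp only [Fin.forall_fin_two, Matrix.cons_val_zero, Matrix.cons_val_one]
      exact ⟨(ha.sup hb).exp_two_mul_of_le hab hmax, (ha.inf hb).exp_two_mul_of_le hab hmin⟩)
    (fun ζ => by
      simp only [Fin.sum_univ_two, Matrix.cons_val_zero, Matrix.cons_val_one]
      rcases le_total (a ζ) (b ζ) with h | h
      · rw [max_eq_right h, min_eq_left h, add_comm]
      · rw [max_eq_left h, min_eq_right h])
    (fun z hz => by
      simpa [Fin.sum_univ_two] using norm_sq_add_norm_sq_outerExp_le ha hb hz)
  simpa [Fin.sum_univ_two] using this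

/-- The function is the square of `outerExp m`, whose modulus is at most 1, and `(F²)' = 2FF'`. -/
lemma dirichletIntegral_outerExp_add_self_le {m : ℂ → ℝ} (hm : CircleIntegrable m 0 1)
    (hm0 : ∀ ζ, m ζ ≤ 0) :
    dirichletIntegral ω (outerExp fun ζ => m ζ + m ζ) ≤ 4 * dirichletIntegral ω (outerExp m) := by
  rw [dirichletIntegral, dirichletIntegral, ← mul_div_assoc, ← lintegral_const_mul' _ _ (by simp)]
  refine ENNReal.div_le_div_right (setLIntegral_mono' isOpen_ball.measurableSet fun z hz => ?_) _
  have h1 : (outerExp fun ζ => m ζ + m ζ) =ᶠ[𝓝 z] fun z => outerExp m z * outerExp m z := by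
    filter_upwards [isOpen_ball.mem_nhds hz] with w hw using outerExp_add hm hm hw
  have hd : DifferentiableAt ℂ (outerExp m) z :=
    (differentiableOn_outerExp hm).differentiableAt (isOpen_ball.mem_nhds hz)
  have h2 : ‖outerExp m z‖ₑ ≤ 1 := by
    have := norm_outerExp_mono hm (circleIntegrable_const (0 : ℝ) _ _) hm0 hz
    rw [outerExp_const 0 hz] at this
    rw [← ofReal_norm, ← ENNReal.ofReal_one]
    exact ENNReal.ofReal_le_ofReal (by simpa using this)
  rw [h1.deriv_eq, deriv_fun_mul hd hd, ← mul_assoc]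
  gcongr
  calc ‖deriv (outerExp m) z * outerExp m z + outerExp m z * deriv (outerExp m) z‖ₑ ^ 2
      = (2 * ‖outerExp m z‖ₑ * ‖deriv (outerExp m) z‖ₑ) ^ 2 := by
        have : deriv (outerExp m) z * outerExp m z + outerExp m z * deriv (outerExp m) z =
          2 * outerExp m z * deriv (outerExp m) z := by ring
        rw [this, enorm_mul, enorm_mul]
        congr 3
        rw [← ofReal_norm]
        simp
    _ ≤ (2 * 1 * ‖deriv (outerExp m) z‖ₑ) ^ 2 := by gcongr
    _ = 4 * ‖deriv (outerExp m) z‖ₑ ^ 2 := by ring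

/-- With `H = |outerExp m|` and `K = |outerExp k|`, the left-hand function has modulus `H²K`. A
three-against-three comparison leaves the integral of `(outerExp m)²` on the right, which the term
`4 D(outerExp m)` on the left absorbs. -/
lemma dirichletIntegral_add_min_zero_le (hω : IsSuperharmonicWeight ω)
    (ha : CircleIntegrable a 0 1) (ha2 : CircleIntegrable (fun ζ => exp (2 * a ζ)) 0 1) :
    dirichletIntegral ω (outerExp fun ζ => a ζ + min (a ζ) 0) ≤
      4 * dirichletIntegral ω (outerExp a) := by
  have h0 : CircleIntegrable (fun _ : ℂ => (0 : ℝ)) 0 1 := circleIntegrable_const _ _ _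
  have hk : CircleIntegrable (fun ζ => max (a ζ) 0) 0 1 := ha.sup h0
  have hm : CircleIntegrable (fun ζ => min (a ζ) 0) 0 1 := ha.inf h0
  set k : ℂ → ℝ := fun ζ => max (a ζ) 0 with hkdef
  set m : ℂ → ℝ := fun ζ => min (a ζ) 0 with hmdef
  have hm0 : ∀ ζ, m ζ ≤ 0 := fun ζ => min_le_right _ _
  have hk0 : ∀ ζ, 0 ≤ k ζ := fun ζ => le_max_right _ _
  have hmk : ∀ ζ, m ζ + k ζ = a ζ := fun ζ => by
    simp only [hmdef, hkdef]
    rw [min_add_max, add_zero]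
  -- The lattice inequality against the constant 1 makes the integral of `outerExp m` finite, as the
  -- final cancellation requires.
  have hle := dirichletIntegral_max_add_min_le hω ha h0 ha2 (by simp)
  rw [dirichletIntegral_outerExp_const, add_zero] at hle
  rcases eq_or_ne (dirichletIntegral ω (outerExp a)) ∞ with htop | htop
  · rw [htop]
    simp
  have hmtop : dirichletIntegral ω (outerExp m) ≠ ∞ :=
    ne_top_of_le_ne_top htop (le_add_self.trans hle)
  set l2 := Real.log 2
  set l3 := Real.log 3 / 2
  have e2 : exp l2 = 2 := exp_log (by norm_num)
  have e3 : exp l3 ^ 2 = 3 := by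
    rw [← exp_nat_mul]
    simp only [l3]
    rw [Nat.cast_ofNat, mul_div_cancel₀ _ (by norm_num)]
    exact exp_log (by norm_num)
  have ex2 : ∀ x : ℝ, exp (2 * x) = exp x ^ 2 := fun x => by rw [← exp_nat_mul]; norm_num
  have hconst : ∀ c : ℝ, CircleIntegrable (fun _ : ℂ => c) 0 1 := fun c =>
    circleIntegrable_const _ _ _
  -- The moduli are `2HK, H², √3` against `H²K, √3K, 2H`. On the circle either `K = 1` or `H = 1`,
  -- and in both cases the sums of squares agree.
  have key := sum_dirichletIntegral_outerExp_le (ω := ω)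
    (a := ![fun ζ => a ζ + l2, fun ζ => m ζ + m ζ, fun _ => l3])
    (b := ![fun ζ => a ζ + m ζ, fun ζ => k ζ + l3, fun ζ => m ζ + l2]) hω
    (by
      intro i
      fin_cases i
      exacts [ha.add (hconst l2), hm.add hm, hconst l3])
    (by
      intro i
      fin_cases i
      exacts [ha.add hm, hk.add (hconst l3), hm.add (hconst l2)])
    (by
      intro i
      fin_cases i
      · refine (ha.add (hconst l2)).exp_two_mul_of_le (ha2.const_smul (a := (4 : ℝ))) fun ζ => ?_
        simp only [Pi.smul_apply, smul_eq_mul, Pi.add_apply]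
        rw [ex2, exp_add, e2, mul_pow, ex2]
        linarith
      · exact (hm.add hm).exp_two_mul_of_le (hconst 1) fun ζ => by
          simp only [Pi.add_apply, exp_le_one_iff]
          linarith [hm0 ζ]
      · exact hconst (exp (2 * l3)))
    (by
      intro i
      fin_cases i
      · exact (ha.add hm).exp_two_mul_of_le ha2 fun ζ => by
          simp only [Pi.add_apply, exp_le_exp]
          linarith [hm0 ζ]
      · refine (hk.add (hconst l3)).exp_two_mul_of_le ((ha2.add (hconst 1)).const_smul (a := (3 : ℝ)))
          fun ζ => ?_
        simp only [Pi.smul_apply, smul_eq_mul, Pi.add_apply]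
        rw [ex2, exp_add, mul_pow, e3, ← ex2, mul_comm]
        simp only [hkdef]
        rcases max_choice (a ζ) 0 with h | h <;> rw [h]
        · linarith
        · rw [mul_zero, exp_zero]
          linarith [exp_pos (2 * a ζ)]
      · refine (hm.add (hconst l2)).exp_two_mul_of_le (hconst 4) fun ζ => ?_
        simp only [Pi.add_apply]
        rw [ex2, exp_add, e2]
        have := exp_le_one_iff.2 (hm0 ζ)
        nlinarith [exp_pos (m ζ)])
    (fun ζ => by
      simp only [Fin.sum_univ_three, Matrix.cons_val_zero, Matrix.cons_val_one, Matrix.cons_val]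
      rw [ex2, ex2, ex2, ex2, ex2, ex2, exp_add, exp_add, exp_add, exp_add, exp_add, mul_pow,
        mul_pow (exp (k ζ)), e2, e3]
      simp only [hkdef, hmdef]
      rcases le_total (a ζ) 0 with h | h
      · rw [max_eq_right h, min_eq_left h, exp_zero]
        ring
      · rw [max_eq_left h, min_eq_right h, exp_zero]
        ring)
    (fun z hz => by
      simp only [Fin.sum_univ_three, Matrix.cons_val_zero, Matrix.cons_val_one, Matrix.cons_val]
      have hA : outerExp a z = outerExp m z * outerExp k z := by
        rw [← outerExp_add hm hk hz]
        simp only [hmk]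
      rw [outerExp_add_const ha l2 hz, outerExp_add hm hm hz, outerExp_const l3 hz,
        outerExp_add ha hm hz, outerExp_add_const hk l3 hz, outerExp_add_const hm l2 hz, hA]
      have hH : ‖outerExp m z‖ ≤ 1 := by
        have := norm_outerExp_mono hm h0 hm0 hz
        rw [outerExp_const 0 hz] at this
        simpa using this
      have hK : 1 ≤ ‖outerExp k z‖ := by
        have := norm_outerExp_mono h0 hk hk0 hz
        rw [outerExp_const 0 hz] at this
        simpa using this
      have n2 : ‖((exp l2 : ℝ) : ℂ)‖ = 2 := by
        rw [Complex.norm_real, e2]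
        norm_num
      have n3 : ‖((exp l3 : ℝ) : ℂ)‖ ^ 2 = 3 := by
        rw [Complex.norm_real, Real.norm_of_nonneg (exp_pos _).le, e3]
      simp only [norm_mul, mul_pow, n2, n3]
      set H := ‖outerExp m z‖
      set K := ‖outerExp k z‖
      have hH0 : 0 ≤ H := norm_nonneg _
      have hH2 : H ^ 2 ≤ 1 := by nlinarith
      have hK2 : 1 ≤ K ^ 2 := by nlinarith
      -- Inside the disc the difference of the sums of squares factors as `(K² - 1)(1 - H²)(3 -
      -- H²)`.
      have := mul_nonneg (mul_nonneg (sub_nonneg.2 hK2) (sub_nonneg.2 hH2))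
        (show 0 ≤ 3 - H ^ 2 by linarith)
      nlinarith)
  simp only [Fin.sum_univ_three, Matrix.cons_val_zero, Matrix.cons_val_one, Matrix.cons_val] at key
  rw [dirichletIntegral_outerExp_add_const ha, dirichletIntegral_outerExp_const, add_zero,
    dirichletIntegral_outerExp_add_const hm, e2] at key
  norm_num at key
  refine (ENNReal.add_le_add_iff_right (a := 4 * dirichletIntegral ω (outerExp m))
    (by finiteness)).1 ?_
  calc _ ≤ _ := by gcongr; exact le_self_add
    _ ≤ _ := key
    _ ≤ _ := by gcongr; exact dirichletIntegral_outerExp_add_self_le hm hm0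

end Lattice

theorem theorem2p4 (ω : ℂ → ℝ≥0∞) (hω : IsSuperharmonicWeight ω) (f g : ℂ → ℂ)
    (hf : IsOuter f) (hf2 : MemHardy 2 f) (hg : IsOuter g) (hg2 : MemHardy 2 g) :
    dirichletIntegral ω (outerSup f g) ≤ dirichletIntegral ω f + dirichletIntegral ω g ∧
    dirichletIntegral ω (outerInf f g) ≤ dirichletIntegral ω f + dirichletIntegral ω g ∧
    dirichletIntegral ω (outerInf f (fun z => f z ^ 2)) ≤ 4 * dirichletIntegral ω f := by
  obtain ⟨α, a, hα, ha, ha2, hfa, hfn, hfn2⟩ := hf.exists_boundary hf2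
  obtain ⟨β, b, hβ, hb, hb2, hgb, hgn, -⟩ := hg.exists_boundary hg2
  have hDf : dirichletIntegral ω f = dirichletIntegral ω (outerExp a) := by
    rw [dirichletIntegral_const_mul α hfa, enorm_sq_eq_ofReal, hα]
    simp
  have hDg : dirichletIntegral ω g = dirichletIntegral ω (outerExp b) := by
    rw [dirichletIntegral_const_mul β hgb, enorm_sq_eq_ofReal, hβ]
    simp
  have hsup : outerSup f g = outerExp fun ζ => max (a ζ) (b ζ) := by
    refine outerExp_congr_ae ?_
    filter_upwards [hfn, hgn] with x h1 h2
    rw [h1, h2, ← exp_monotone.map_max, log_exp]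
  have hinf : outerInf f g = outerExp fun ζ => min (a ζ) (b ζ) := by
    refine outerExp_congr_ae ?_
    filter_upwards [hfn, hgn] with x h1 h2
    rw [h1, h2, ← exp_monotone.map_min, log_exp]
  have hinf2 : outerInf f (fun z => f z ^ 2) = outerExp fun ζ => a ζ + min (a ζ) 0 := by
    refine outerExp_congr_ae ?_
    filter_upwards [hfn, hfn2] with x h1 h2
    -- The logarithm of the boundary modulus is `min(a, 2a) = a + min(a, 0)`.
    rw [h1, h2, ← exp_monotone.map_min, log_exp, min_comm, ← min_add_add_left, add_zero, two_mul]
  have hmain := dirichletIntegral_max_add_min_le hω ha hb ha2 hb2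
  rw [hsup, hinf, hinf2, hDf, hDg]
  exact ⟨le_self_add.trans hmain, le_add_self.trans hmain,
    dirichletIntegral_add_min_zero_le hω ha ha2⟩
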